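/- Let $K$ be a field of characteristic $0$ (for instance $\mathbb{Q}(q,t)$) and let $\Lambda=K[p_1,p_2,\dots]$ be the ring of symmetric functions over $K$, with power sums $p_k$, complete homogeneous functions $h_n$, Schur functions $s_\lambda$, the involution $\omega(p_k)=(-1)^{k-1}p_k$, and the operators $f^\perp$ adjoint to multiplication by $f$ for the scalar product $\langle p_\lambda,p_\mu\rangle=\delta_{\lambda\mu}z_\lambda$. For an expression $E$ with integer coefficients in $X=x_1+x_2+\cdots$ and variables $z_1^{\pm1},z_2^{\pm 1},\dots$, let $p_k[E]$ be $E$ with all variables replaced by their $k$-th powers (so $p_k[X]=p_k$); $P[E]$ is obtained from the power sum expansion of $P\in\Lambda$ by substituting $p_k[E]$ for $p_k$, and $\Omega[E]=\sum_{n\ge0}h_n[E]$. Write $F\big|_{z^a}$ for the coefficient of $z^a$ in $F$. For $k\in\mathbb{Z}$ put $S_kP[X]=P[X-1/z]\,\Omega[zX]\big|_{z^k}$ and $\tilde S_k=\omega S_k\omega$. Let $\lambda$ be a non-empty partition with $\lambda_1+\ell(\lambda)-1=m$, let $\lambda^{rc}=(\lambda_2-1,\dots,\lambda_{\ell(\lambda)}-1)$,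 and let $R=\lambda/\lambda^{rc}$, a ribbon with $m$ cells. In French notation (longest row at the bottom) number the cells of $R$ by $1,\dots,m$ from left to right and top to bottom, and let $D(R)\subseteq\{1,\dots,m-1\}$ be the set of $i$ such that cell $i+1$ lies below cell $i$. Let $S^R=s_{\lambda^{rc}}^\perp\,\tilde S_{\lambda_1'}\tilde S_{\lambda_2'}\cdots\tilde S_{\lambda_{\lambda_1}'}$, where $\lambda_i'$ is the length of the $i$-th column of $\lambda$. Then for every $P\in\Lambda$ $$S^R P[X]=(-1)^{m-|D(R)|}\;P[X+Z^*]\;\Omega\big[-(z_1+Z_{D(R)^c+1})X\big]\prod_{1\le i<j\le m}(1-z_j/z_i)\Big|_{z_1z_2\cdots z_m},$$ where $Z^*=\sum_{i=1}^m 1/z_i$ and $Z_{D(R)^c+1}=\sum_{i\in\{1,\dots,m-1\}\setminus D(R)}z_{i+1}$. -/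

import Mathlib

namespace RibbonOp

noncomputable section

/-! ### Symmetric functions -/

/-- The ring `Λ` of symmetric functions over a field `K` of characteristic zero, as the polynomial
ring `K[p₁, p₂, p₃, …]` in the power sums; `X k` is the power sum `p_k`. -/
abbrev Lam (K : Type*) [Field K] : Type _ := MvPolynomial ℕ+ K

/-- The power sum `p_k`. -/
def p (K : Type*) [Field K] (k : ℕ+) : Lam K := MvPolynomial.X k

/-- The complete homogeneous symmetric function `h_n`, determined by `h₀ = 1` and
`n h_n = ∑_{r=1}^{n} p_r h_{n-r}`. -/
def h (K : Type*) [Field K] : ℕ → Lam K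
  | 0 => 1
  | n + 1 => MvPolynomial.C ((n + 1 : K)⁻¹) *
      ∑ i : Fin (n + 1), p K (Nat.succPNat i) * h K (n - i)

/-- `h_n` for an integer index, with `h_n = 0` for `n < 0`. -/
def hInt (K : Type*) [Field K] (n : ℤ) : Lam K := if 0 ≤ n then h K n.toNat else 0

/-- The Schur function `s_μ = det (h_{μ_i - i + j})`. -/
def schur (K : Type*) [Field K] (μ : YoungDiagram) : Lam K :=
  Matrix.det (Matrix.of fun i j : Fin (μ.colLen 0) =>
    hInt K ((μ.rowLen i : ℤ) - (i : ℤ) + (j : ℤ)))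

/-- The involution `ω` with `ω p_k = (-1)^(k-1) p_k`. -/
def omega (K : Type*) [Field K] : Lam K →ₐ[K] Lam K :=
  MvPolynomial.aeval fun k : ℕ+ => (-1 : Lam K) ^ ((k : ℕ) - 1) * p K k

/-- `z_d = ∏_k k^{d_k} d_k!`, for the partition with `d_k` parts equal to `k`. -/
def zee (K : Type*) [Field K] (d : ℕ+ →₀ ℕ) : K :=
  d.prod fun k e => ((k : ℕ) : K) ^ e * (e.factorial : K)

/-- The standard (Hall) scalar product: `⟨p_λ, p_μ⟩ = δ_{λμ} z_λ`. -/
def hall {K : Type*} [Field K] (f g : Lam K) : K :=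
  ∑ d ∈ f.support, f.coeff d * g.coeff d * zee K d

/-- The operator `f^⊥`: `f^⊥ g = ∑_λ ⟨g, f p_λ⟩ p_λ / z_λ`. The sum is restricted to those `p_λ`
which divide a monomial of `g`, since `⟨g, f p_λ⟩ = 0` for all others. -/
def perp {K : Type*} [Field K] (f g : Lam K) : Lam K :=
  ∑ d ∈ g.support.biUnion (fun e => Finset.Iic e),
    MvPolynomial.monomial d (hall g (f * MvPolynomial.monomial d 1) / zee K d)

/-! ### Plethystic notation -/

/-- The Laurent polynomials in `z₀, z₁, z₂, …` with coefficients in `Λ = Λ^X`. -/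
abbrev LaurentLam (K : Type*) [Field K] : Type _ := AddMonoidAlgebra (Lam K) (ℕ →₀ ℤ)

/-- The power `z_i ^ e` of a variable. -/
def z (K : Type*) [Field K] (i : ℕ) (e : ℤ) : LaurentLam K :=
  AddMonoidAlgebra.single (Finsupp.single i e) 1

/-- The alphabet `X = x₁ + x₂ + ⋯`, that is, `p₁`. -/
def X (K : Type*) [Field K] : LaurentLam K := AddMonoidAlgebra.single 0 (p K 1)

/-- `p_k[E]`: every variable `x_i` and `z_i` of `E` is replaced by its `k`-th power, so that `p_j`
becomes `p_{kj}`. The scalars are left alone; the expressions `E` below have integer coefficients. -/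
def powerSub (K : Type*) [Field K] (k : ℕ+) : LaurentLam K →+* LaurentLam K :=
  (AddMonoidAlgebra.mapDomainRingHom (Lam K)
      (DistribSMul.toAddMonoidHom (ℕ →₀ ℤ) (k : ℕ))).comp
    (AddMonoidAlgebra.mapRingHom (ℕ →₀ ℤ)
      (MvPolynomial.aeval (fun j : ℕ+ => p K (k * j)) : Lam K →ₐ[K] Lam K).toRingHom)

/-- The plethystic substitution `P[E]`: expand `P` in the power sums and replace `p_k` by
`p_k[E]`. -/
def pleth {K : Type*} [Field K] (P : Lam K) (E : LaurentLam K) : LaurentLam K :=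
  MvPolynomial.aeval (fun k : ℕ+ => powerSub K k E) P

/-- The coefficient of the monomial `z^a` in `F · Ω[E]`, where `Ω[E] = ∑_{n ≥ 0} h_n[E]`.
For the `E` used below (homogeneous of degree `1` in the `z_i`) only finitely many `n`
contribute, see `coeffOmega_finite`. -/
def coeffOmega {K : Type*} [Field K] (F E : LaurentLam K) (a : ℕ →₀ ℤ) : Lam K :=
  ∑ᶠ n : ℕ, (F * pleth (h K n) E).coeff a

/-! ### Creation operators -/

/-- Bernstein's operator: `S_m P[X] = P[X - 1/z] Ω[zX] |_{z^m}`. -/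
def S {K : Type*} [Field K] (m : ℤ) (P : Lam K) : Lam K :=
  coeffOmega (pleth P (X K - z K 1 (-1))) (z K 1 1 * X K) (Finsupp.single 1 m)

/-- The operator which adds a column: `S̃_m = ω S_m ω`. -/
def Stilde {K : Type*} [Field K] (m : ℤ) (P : Lam K) : Lam K :=
  omega K (S m (omega K P))

/-! ### Ribbons

A cell `(i, j)` lies in row `i` and column `j`. In the French convention used here row `0`, the
longest one, is at the bottom. -/

/-- The partition `λ^rc = (λ₂ - 1, λ₃ - 1, …)`: first row and first column are removed. -/
def rc (lam : YoungDiagram) : YoungDiagram where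
  cells := lam.cells.filter fun c => (c.1 + 1, c.2 + 1) ∈ lam.cells
  isLowerSet := by
    intro a b hab ha
    simp only [Finset.coe_filter, Set.mem_ofPred_eq, YoungDiagram.mem_cells] at ha ⊢
    exact ⟨lam.isLowerSet hab ha.1,
      lam.isLowerSet (Prod.mk_le_mk.2 ⟨Nat.succ_le_succ hab.1, Nat.succ_le_succ hab.2⟩) ha.2⟩

/-- The cells of the ribbon `λ / λ^rc`. -/
def ribbon (lam : YoungDiagram) : Finset (ℕ × ℕ) := lam.cells \ (rc lam).cells

/-- The label of a cell of the ribbon when its cells are numbered `1, 2, …` from left to right and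
top to bottom. -/
def label (lam : YoungDiagram) (c : ℕ × ℕ) : ℕ :=
  ((ribbon lam).filter fun d => d.2 ≤ c.2 ∧ c.1 ≤ d.1).card

/-- The descent set `D(R)` of the ribbon `R = λ / λ^rc` of size `m`: all `i` in `{1, …, m-1}` such
that the `(i+1)`-st cell lies below the `i`-th cell. -/
def descents (lam : YoungDiagram) : Finset ℕ :=
  (Finset.Icc 1 ((ribbon lam).card - 1)).filter fun i =>
    ∃ c ∈ ribbon lam, ∃ d ∈ ribbon lam,
      label lam c = i ∧ label lam d = i + 1 ∧ d.1 < c.1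

/-- The ribbon operator `S^R = s_{λ^rc}^⊥ S̃_{λ'₁} S̃_{λ'₂} ⋯ S̃_{λ'_{λ₁}}` for `R = λ / λ^rc`. -/
def ribbonOp {K : Type*} [Field K] (lam : YoungDiagram) (P : Lam K) : Lam K :=
  perp (schur K (rc lam))
    ((List.range (lam.rowLen 0)).foldr (fun j Q => Stilde (lam.colLen j : ℤ) Q) P)

/-! ### Well-definedness of `perp` and `coeffOmega` -/

theorem zee_ne_zero {K : Type*} [Field K] [CharZero K] (d : ℕ+ →₀ ℕ) : zee K d ≠ 0 := by
  unfold zee Finsupp.prod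
  refine Finset.prod_ne_zero_iff.2 fun k _ => mul_ne_zero (pow_ne_zero _ ?_) ?_
  · exact_mod_cast k.ne_zero
  · exact_mod_cast Nat.factorial_ne_zero _

theorem hall_eq_sum {K : Type*} [Field K] (f g : Lam K) (s : Finset (ℕ+ →₀ ℕ))
    (hs : ∀ d, f.coeff d ≠ 0 → g.coeff d ≠ 0 → d ∈ s) :
    hall f g = ∑ d ∈ s, f.coeff d * g.coeff d * zee K d := by
  classical
  have h1 : hall f g = ∑ d ∈ f.support ∪ s, f.coeff d * g.coeff d * zee K d := by
    refine Finset.sum_subset Finset.subset_union_left fun d _ hd => ?_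
    rw [MvPolynomial.notMem_support_iff.1 hd, zero_mul, zero_mul]
  rw [h1]
  refine (Finset.sum_subset Finset.subset_union_right fun d _ hd => ?_).symm
  by_cases hf : f.coeff d = 0
  · rw [hf, zero_mul, zero_mul]
  · by_cases hg : g.coeff d = 0
    · rw [hg, mul_zero, zero_mul]
    · exact absurd (hs d hf hg) hd

theorem coeff_perp {K : Type*} [Field K] (f g : Lam K) (d : ℕ+ →₀ ℕ) :
    (perp f g).coeff d = hall g (f * MvPolynomial.monomial d 1) / zee K d := by
  classical
  unfold perp
  rw [MvPolynomial.coeff_sum]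
  simp only [MvPolynomial.coeff_monomial]
  rw [Finset.sum_ite_eq']
  split_ifs with hd
  · rfl
  · have h0 : hall g (f * MvPolynomial.monomial d 1) = 0 := by
      rw [hall_eq_sum g _ ∅, Finset.sum_empty]
      intro e he he'
      refine absurd ?_ hd
      rw [MvPolynomial.coeff_mul_monomial'] at he'
      refine Finset.mem_biUnion.2 ⟨e, MvPolynomial.mem_support_iff.2 he, Finset.mem_Iic.2 ?_⟩
      by_contra hle
      exact he' (if_neg hle)
    rw [h0, zero_div]

/-- `f^⊥` is dual to multiplication by `f` with respect to the scalar product. -/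
theorem hall_perp {K : Type*} [Field K] [CharZero K] (f g q : Lam K) :
    hall (perp f g) q = hall g (f * q) := by
  classical
  rw [hall_eq_sum _ q q.support fun d _ hd => MvPolynomial.mem_support_iff.2 hd]
  have h1 : ∀ d ∈ q.support, (perp f g).coeff d * q.coeff d * zee K d =
      ∑ e ∈ g.support, g.coeff e *
        (q.coeff d * (f * MvPolynomial.monomial d 1).coeff e) * zee K e := by
    intro d _
    have h2 : (perp f g).coeff d * zee K d = hall g (f * MvPolynomial.monomial d 1) := by
      rw [coeff_perp, div_mul_cancel₀ _ (zee_ne_zero d)]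
    rw [mul_right_comm, h2, hall, Finset.sum_mul]
    exact Finset.sum_congr rfl fun e _ => by ring
  rw [Finset.sum_congr rfl h1, Finset.sum_comm, hall]
  refine Finset.sum_congr rfl fun e _ => ?_
  rw [← Finset.sum_mul, ← Finset.mul_sum]
  congr 2
  conv_rhs => rw [q.as_sum, Finset.mul_sum, MvPolynomial.coeff_sum]
  refine Finset.sum_congr rfl fun d _ => ?_
  rw [← MvPolynomial.coeff_C_mul, mul_left_comm, MvPolynomial.C_mul_monomial, mul_one]

/-- `F` is homogeneous of degree `n` in the variables `z_i`. -/
def ZHomogeneous {K : Type*} [Field K] (F : LaurentLam K) (n : ℤ) : Prop :=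
  ∀ a, F.coeff a ≠ 0 → a.degree = n

theorem ZHomogeneous.mul {K : Type*} [Field K] {F G : LaurentLam K} {n k : ℤ}
    (hF : ZHomogeneous F n) (hG : ZHomogeneous G k) : ZHomogeneous (F * G) (n + k) := by
  classical
  intro a ha
  have h1 := AddMonoidAlgebra.support_coeff_mul_subset F G (Finsupp.mem_support_iff.2 ha)
  obtain ⟨b, hb, c, hc, rfl⟩ := Finset.mem_add.1 h1
  rw [map_add, hF b (Finsupp.mem_support_iff.1 hb), hG c (Finsupp.mem_support_iff.1 hc)]

theorem ZHomogeneous.sum {K ι : Type*} [Field K] (s : Finset ι) (F : ι → LaurentLam K) (n : ℤ)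
    (hF : ∀ i ∈ s, ZHomogeneous (F i) n) : ZHomogeneous (∑ i ∈ s, F i) n := by
  intro a ha
  rw [AddMonoidAlgebra.coeff_sum, Finsupp.finsetSum_apply] at ha
  obtain ⟨i, hi, h1⟩ := Finset.exists_ne_zero_of_sum_ne_zero ha
  exact hF i hi a h1

theorem ZHomogeneous.powerSub {K : Type*} [Field K] {E : LaurentLam K}
    (hE : ZHomogeneous E 1) (k : ℕ+) : ZHomogeneous (powerSub K k E) k := by
  classical
  intro a ha
  have h1 := Finsupp.mapDomain_support (Finsupp.mem_support_iff.2 ha)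
  obtain ⟨b, hb, rfl⟩ := Finset.mem_image.1 h1
  have h2 : E.coeff b ≠ 0 := by
    intro h0
    apply Finsupp.mem_support_iff.1 hb
    simp [h0]
  have h3 := hE b h2
  change ((k : ℕ) • b).degree = _
  rw [map_nsmul, h3]
  simp

theorem ZHomogeneous.pleth_h {K : Type*} [Field K] {E : LaurentLam K} (hE : ZHomogeneous E 1)
    (n : ℕ) : ZHomogeneous (pleth (h K n) E) n := by
  induction n using Nat.strong_induction_on with
  | _ n ih =>
    cases n with
    | zero =>
      intro a ha
      have h1 : pleth (h K 0) E = AddMonoidAlgebra.single 0 1 := by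
        rw [h, pleth, map_one]; rfl
      rw [h1, AddMonoidAlgebra.coeff_single] at ha
      by_cases h0 : a = 0
      · simp [h0]
      · exact absurd (Finsupp.single_eq_of_ne h0) ha
    | succ n =>
      have h1 : pleth (h K (n + 1)) E = AddMonoidAlgebra.single 0 (MvPolynomial.C (n + 1 : K)⁻¹) *
          ∑ i : Fin (n + 1),
            RibbonOp.powerSub K (Nat.succPNat i) E * pleth (h K (n - i)) E := by
        simp only [pleth]
        rw [h, map_mul, map_sum]
        congr 1
        · rw [MvPolynomial.aeval_C]; rfl
        · refine Finset.sum_congr rfl fun i _ => ?_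
          rw [map_mul, p, MvPolynomial.aeval_X]
      rw [h1, ← zero_add ((n + 1 : ℕ) : ℤ)]
      refine ZHomogeneous.mul ?_ (ZHomogeneous.sum _ _ _ fun i _ => ?_)
      · intro a ha
        rw [AddMonoidAlgebra.coeff_single] at ha
        by_cases h0 : a = 0
        · simp [h0]
        · exact absurd (Finsupp.single_eq_of_ne h0) ha
      · have h2 := (hE.powerSub (Nat.succPNat i)).mul (ih (n - i) (by omega))
        have h3 : (((Nat.succPNat i : ℕ+) : ℕ) : ℤ) + ((n - i : ℕ) : ℤ) = ((n + 1 : ℕ) : ℤ) := by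
          rw [Nat.succPNat_coe]; have := i.2; push_cast; omega
        rwa [h3] at h2

/-- Only finitely many terms contribute to `coeffOmega F E a` if `E` is homogeneous of degree `1`
in the `z_i`. -/
theorem coeffOmega_finite {K : Type*} [Field K] (F E : LaurentLam K) (hE : ZHomogeneous E 1)
    (a : ℕ →₀ ℤ) : {n : ℕ | (F * pleth (h K n) E).coeff a ≠ 0}.Finite := by
  classical
  refine (F.coeff.support.image fun b => (a.degree - b.degree).toNat).finite_toSet.subset ?_
  intro n hn
  obtain ⟨b, hb, c, hc, rfl⟩ := Finset.mem_add.1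
    (AddMonoidAlgebra.support_coeff_mul_subset F _ (Finsupp.mem_support_iff.2 hn))
  have h1 := hE.pleth_h n c (Finsupp.mem_support_iff.1 hc)
  refine Finset.mem_coe.2 (Finset.mem_image.2 ⟨b, hb, ?_⟩)
  rw [map_add, h1]
  simp

end

end RibbonOp

namespace RibbonOp

noncomputable section

open MvPolynomial (aeval)

/-! ### Complete homogeneous functions and plethysm -/

section Homogeneous

variable {K A : Type*} [Field K] [CommRing A] [Algebra K A]

/-! Every operator in S^R extracts a coefficient in one variable: Q ↦ Q[X+1/z] Ω[-zX] at z^e (a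
marked slot) or Q ↦ Q[X+1/z] at z^e (an unmarked slot). Applying ω together with z ↦ -z shows that
S̃_n is (-1)^n times the marked slot operator with e = n (`Stilde_eq_slotOp`). Since Q[X+u] = ∑ u^n
h_n^⊥ Q (`translate_coeff_eq_perp`), h_n^⊥ is the unmarked one with e = -n (`perp_hInt_eq_slotOp`).

To compose slot operators, the substitution X ↦ X + 1/z_i of an outer one is pushed through the
Ω[-z_j X] of an inner marked one. This costs Ω[-z_j/z_i] = 1 - z_j/z_i (`shift_extract`), so a
composite is one multivariate extraction from P[X+Z^*], with such a factor for each pair i before j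
with j marked (`foldr_slotOp`). The pairs of unmarked slots come from s_{λ^rc}^⊥: in the
Jacobi–Trudi determinant a permutation only changes the exponents by i - σ(i), and the signed sum of
the monomials ∏ z_i^{i-σ(i)} is a Vandermonde product (`single_zero_perp_det`).

Both sides of the theorem are now extractions with the full product ∏(1 - z_j/z_i), but with
variables in different orders and with different exponents. Multiplying by the staircase monomial
turns the product into ∏(z_i - z_j), which is antisymmetric, and adds to each exponent the number of
later slots. On the right the exponents 1,…,1 become m,…,1. On the left the rows of λ^rc and the
columns of λ give the same variables with the same exponents, unmarked ones first
(`staircase_operatorSlots`): this is the complementarity of the row and column steps along the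
boundary of λ.

Sorting costs (-1)^inv, where inv counts the marked variables standing before unmarked ones, and inv
= ∑ λ'_j - λ_1 (`inversions_staircase_positionSlots`). With the sign (-1)^{∑ λ'_j} of the S̃
operators this leaves (-1)^{λ_1}, and λ_1 = m - |D(R)| because D(R) has ℓ(λ) - 1 elements. -/

theorem natCast_succ_mul_cancel [CharZero K] (n : ℕ) {x y : A}
    (hxy : ((n : A) + 1) * x = ((n : A) + 1) * y) : x = y := by
  have h0 : ((n : K) + 1) ≠ 0 := by exact_mod_cast n.succ_ne_zero
  have h1 : algebraMap K A ((n : K) + 1)⁻¹ * ((n : A) + 1) = 1 := by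
    have : ((n : A) + 1) = algebraMap K A ((n : K) + 1) := by simp
    rw [this, ← map_mul, inv_mul_cancel₀ h0, map_one]
  rw [← one_mul x, ← one_mul y, ← h1, mul_assoc, hxy, mul_assoc]

theorem succ_mul_aeval_h_succ [CharZero K] (a : ℕ+ → A) (n : ℕ) :
    ((n : A) + 1) * aeval a (h K (n + 1)) =
      ∑ i ∈ Finset.range (n + 1), a (Nat.succPNat i) * aeval a (h K (n - i)) := by
  have h0 : ((n : K) + 1) ≠ 0 := by exact_mod_cast n.succ_ne_zero
  have h1 : ((n : A) + 1) * algebraMap K A ((n : K) + 1)⁻¹ = 1 := by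
    have : ((n : A) + 1) = algebraMap K A ((n : K) + 1) := by simp
    rw [this, ← map_mul, mul_inv_cancel₀ h0, map_one]
  rw [h, map_mul, MvPolynomial.aeval_C, ← mul_assoc, h1, one_mul, map_sum,
    Finset.sum_range (fun i => a (Nat.succPNat i) * aeval a (h K (n - i)))]
  simp [p]

theorem aeval_h_zero (a : ℕ+ → A) : aeval a (h K 0) = 1 := by
  rw [h, map_one]

/-- The generating function `Ω[tE] = ∑ h_n[E] t^n`, where `a k = p_k[E]`. -/
def omegaSeries (K : Type*) {A : Type*} [Field K] [CommRing A] [Algebra K A] (a : ℕ+ → A) :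
    PowerSeries A :=
  PowerSeries.mk fun n => aeval a (h K n)

/-- Newton's recursion for h_n, read as a differential equation F' = PF. Together with the
uniqueness below it takes the place of F = exp(∑ p_k t^k/k). -/
theorem derivative_omegaSeries [CharZero K] (a : ℕ+ → A) :
    PowerSeries.derivative A (omegaSeries K a) =
      PowerSeries.mk (fun n => a (Nat.succPNat n)) * omegaSeries K a := by
  ext n
  rw [PowerSeries.coeff_derivative, PowerSeries.coeff_mul,
    Finset.Nat.sum_antidiagonal_eq_sum_range_succ_mk]
  simp only [omegaSeries, PowerSeries.coeff_mk]
  rw [mul_comm, succ_mul_aeval_h_succ]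

/-- The equation expresses n + 1 times the coefficient of t^(n+1) through lower coefficients, and n
+ 1 is invertible. -/
theorem omegaSeries_unique [CharZero K] (a : ℕ+ → A) (F : PowerSeries A)
    (h0 : PowerSeries.coeff 0 F = 1)
    (hF : PowerSeries.derivative A F = PowerSeries.mk (fun n => a (Nat.succPNat n)) * F) :
    F = omegaSeries K a := by
  ext n
  induction n using Nat.strong_induction_on with
  | _ n ih =>
    cases n with
    | zero => rw [h0, omegaSeries, PowerSeries.coeff_mk, aeval_h_zero]
    | succ n =>
      refine natCast_succ_mul_cancel (K := K) n ?_
      rw [mul_comm, ← PowerSeries.coeff_derivative, mul_comm, ← PowerSeries.coeff_derivative, hF,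
        derivative_omegaSeries, PowerSeries.coeff_mul, PowerSeries.coeff_mul]
      refine Finset.sum_congr rfl fun ij hij => ?_
      rw [ih ij.2 (by have := Finset.HasAntidiagonal.mem_antidiagonal.1 hij; omega)]

/-- Logarithmic derivatives add under multiplication, so the product solves the equation that
characterizes the left side. -/
theorem omegaSeries_add [CharZero K] (a b : ℕ+ → A) :
    omegaSeries K (a + b) = omegaSeries K a * omegaSeries K b := by
  refine (omegaSeries_unique (K := K) (a + b) _ ?_ ?_).symm
  · simp [omegaSeries, h]
  · have h1 : PowerSeries.mk (fun n => (a + b) (Nat.succPNat n)) =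
        PowerSeries.mk (fun n => a (Nat.succPNat n)) +
          PowerSeries.mk (fun n => b (Nat.succPNat n)) := by
      ext n; simp
    rw [Derivation.leibniz, derivative_omegaSeries, derivative_omegaSeries, h1]
    simp only [smul_eq_mul]
    ring

theorem aeval_h_add [CharZero K] (a b : ℕ+ → A) (n : ℕ) :
    aeval (a + b) (h K n) =
      ∑ ij ∈ Finset.HasAntidiagonal.antidiagonal n, aeval a (h K ij.1) * aeval b (h K ij.2) := by
  have := congrArg (PowerSeries.coeff n) (omegaSeries_add (K := K) a b)
  simpa [omegaSeries, PowerSeries.coeff_mul] using this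

theorem aeval_h_pow_mul [CharZero K] (a : ℕ+ → A) (t : A) (n : ℕ) :
    aeval (fun k : ℕ+ => t ^ (k : ℕ) * a k) (h K n) = t ^ n * aeval a (h K n) := by
  induction n using Nat.strong_induction_on with
  | _ n ih =>
    cases n with
    | zero => simp [h]
    | succ n =>
      refine natCast_succ_mul_cancel (K := K) n ?_
      rw [succ_mul_aeval_h_succ, mul_left_comm, succ_mul_aeval_h_succ, Finset.mul_sum]
      refine Finset.sum_congr rfl fun i hi => ?_
      have hi := Finset.mem_range.1 hi
      rw [ih (n - i) (by omega), Nat.succPNat_coe]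
      have : t ^ (n + 1) = t ^ (i.succ) * t ^ (n - i) := by rw [← pow_add]; congr 1; omega
      rw [this]; ring

theorem aeval_h_zero_fun [CharZero K] (n : ℕ) :
    aeval (0 : ℕ+ → A) (h K n) = if n = 0 then 1 else 0 := by
  cases n with
  | zero => simp [h]
  | succ n =>
    refine natCast_succ_mul_cancel (K := K) n ?_
    rw [succ_mul_aeval_h_succ]
    simp

/-- Ω[-t] = 1 - t, since the logarithmic derivative of 1 - t is -1/(1 - t). All factors 1 - z_j/z_i
from reordering shifts and extractions originate here. -/
theorem aeval_neg_one_h [CharZero K] (n : ℕ) :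
    aeval (fun _ => (-1 : A)) (h K n) = if n = 0 then 1 else if n = 1 then -1 else 0 := by
  have h1 : omegaSeries K (fun _ => (-1 : A)) = 1 - PowerSeries.X := by
    refine (omegaSeries_unique (K := K) _ _ (by simp) ?_).symm
    have h2 : PowerSeries.mk (fun _ : ℕ => (-1 : A)) = -PowerSeries.mk 1 := by ext n; simp
    rw [h2, neg_mul, PowerSeries.mk_one_mul_one_sub_eq_one]
    simp
  have := congrArg (PowerSeries.coeff n) h1
  rw [omegaSeries, PowerSeries.coeff_mk] at this
  rw [this, map_sub, PowerSeries.coeff_one, PowerSeries.coeff_X]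
  rcases n with _ | _ | n <;> simp

end Homogeneous

/-! ### The adjoint of multiplication by `h_n` -/

section Adjoint

variable {K : Type*} [Field K]

theorem hall_add_right (f g g' : Lam K) : hall f (g + g') = hall f g + hall f g' := by
  simp [hall, mul_add, add_mul, Finset.sum_add_distrib]

theorem hall_smul_right (f g : Lam K) (c : K) : hall f (c • g) = c * hall f g := by
  simp [hall, Finset.mul_sum]
  exact Finset.sum_congr rfl fun _ _ => by ring

theorem hall_comm (f g : Lam K) : hall f g = hall g f := by
  rw [hall_eq_sum f g g.support fun d _ hd => MvPolynomial.mem_support_iff.2 hd, hall]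
  exact Finset.sum_congr rfl fun _ _ => by ring

/-- `f^⊥` is linear in `f`. -/
def perpLeft (g : Lam K) : Lam K →ₗ[K] Lam K where
  toFun f := perp f g
  map_add' f f' := by
    ext d
    rw [MvPolynomial.coeff_add, coeff_perp, coeff_perp, coeff_perp, add_mul, hall_add_right,
      add_div]
  map_smul' c f := by
    ext d
    rw [MvPolynomial.coeff_smul, coeff_perp, coeff_perp, smul_mul_assoc, hall_smul_right,
      RingHom.id_apply, smul_eq_mul, mul_div_assoc]

/-- The linear operator `f^⊥`. -/
def perpRight (f : Lam K) : Lam K →ₗ[K] Lam K where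
  toFun g := perp f g
  map_add' g g' := by
    ext d
    rw [MvPolynomial.coeff_add, coeff_perp, coeff_perp, coeff_perp, hall_comm, hall_add_right,
      add_div, hall_comm, hall_comm _ g']
  map_smul' c g := by
    ext d
    rw [MvPolynomial.coeff_smul, coeff_perp, coeff_perp, hall_comm, hall_smul_right,
      RingHom.id_apply, smul_eq_mul, mul_div_assoc, hall_comm]

theorem hall_one_left (g : Lam K) (d : ℕ+ →₀ ℕ) :
    hall g (MvPolynomial.monomial d 1) = g.coeff d * zee K d := by
  rw [hall_eq_sum g _ {d}]
  · simp
  · intro e _ he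
    rw [MvPolynomial.coeff_monomial] at he
    by_contra hne
    exact he (if_neg fun h' => hne (Finset.mem_singleton.2 h'.symm))

theorem zee_add_single (d : ℕ+ →₀ ℕ) (k : ℕ+) :
    zee K (d + Finsupp.single k 1) = zee K d * (((k : ℕ) : K) * ((d k : K) + 1)) := by
  have h1 : ∀ e : ℕ+ →₀ ℕ, zee K e =
      ((k : ℕ) : K) ^ (e k) * ((e k).factorial : K) *
        (e.erase k).prod fun k e => ((k : ℕ) : K) ^ e * (e.factorial : K) := by
    intro e
    rw [zee, ← Finsupp.mul_prod_erase' e k _ fun i => by simp]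
  rw [h1, h1 d, Finsupp.erase_add, Finsupp.erase_single, add_zero]
  simp [pow_succ, Nat.factorial_succ]
  ring

/-- `Q[X + u]` as a polynomial in `u`. -/
def translate (K : Type*) [Field K] : Lam K →ₐ[K] Polynomial (Lam K) :=
  aeval fun k : ℕ+ => Polynomial.C (p K k) + Polynomial.X ^ (k : ℕ)

theorem translate_mul_p_coeff (Q : Lam K) (k : ℕ+) (n : ℕ) :
    (translate K (Q * p K k)).coeff n = (translate K Q).coeff n * p K k +
      if (k : ℕ) ≤ n then (translate K Q).coeff (n - k) else 0 := by
  have h1 : translate K (p K k) = Polynomial.C (p K k) + Polynomial.X ^ (k : ℕ) := by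
    rw [translate, p, MvPolynomial.aeval_X, p]
  rw [map_mul, h1, mul_add, Polynomial.coeff_add, Polynomial.coeff_mul_C,
    Polynomial.coeff_mul_X_pow']

theorem translate_coeff_zero (Q : Lam K) : (translate K Q).coeff 0 = Q := by
  have h1 : ((Polynomial.aeval (0 : Lam K)).restrictScalars K).comp (translate K) =
      AlgHom.id K (Lam K) := by
    refine MvPolynomial.algHom_ext fun k => ?_
    simp [translate, p]
  have h2 := DFunLike.congr_fun h1 Q
  simpa [Polynomial.coeff_zero_eq_aeval_zero] using h2

variable [CharZero K]

theorem perp_mul (f f' g : Lam K) : perp (f * f') g = perp f (perp f' g) := by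
  ext d
  rw [coeff_perp, coeff_perp, hall_perp]
  congr 2
  ring

theorem perp_one (g : Lam K) : perp 1 g = g := by
  ext d
  rw [coeff_perp, one_mul, hall_one_left, mul_div_cancel_right₀ _ (zee_ne_zero d)]

/-- Raising the multiplicity of k in a partition from d_k to d_k + 1 multiplies z by k(d_k + 1); the
factor d_k + 1 is the one produced by ∂/∂p_k. -/
theorem perp_p (k : ℕ+) (g : Lam K) :
    perp (p K k) g = ((k : ℕ) : K) • MvPolynomial.pderiv k g := by
  ext d
  have h1 : p K k * MvPolynomial.monomial d 1 =
      MvPolynomial.monomial (d + Finsupp.single k 1) 1 := by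
    rw [p, MvPolynomial.X, MvPolynomial.monomial_mul, add_comm, one_mul]
  rw [coeff_perp, h1, hall_one_left, zee_add_single, MvPolynomial.coeff_smul,
    MvPolynomial.coeff_pderiv, smul_eq_mul]
  field_simp [zee_ne_zero d]

theorem perp_p_mul_p (Q : Lam K) (k r : ℕ+) :
    perp (p K r) (Q * p K k) =
      perp (p K r) Q * p K k + if r = k then ((k : ℕ) : K) • Q else 0 := by
  rw [perp_p, perp_p, Derivation.leibniz, p, MvPolynomial.pderiv_X]
  by_cases h1 : r = k
  · subst h1
    simp [mul_comm, add_comm]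
  · rw [Pi.single_eq_of_ne (Ne.symm h1), if_neg h1]
    simp [mul_comm]

/-- The coefficient of u^n in u d/du Q[X+u] = ∑_{r≥1} u^r (p_r^⊥ Q)[X+u]. It is the chain rule: u
d/du sends p_r + u^r to r u^r, and p_r^⊥ = r ∂/∂p_r. -/
theorem natCast_mul_translate_coeff (Q : Lam K) (n : ℕ) :
    (n : Lam K) * (translate K Q).coeff n = ∑ r ∈ Finset.range n,
      (translate K (perp (p K (Nat.succPNat r)) Q)).coeff (n - (r + 1)) := by
  induction Q using MvPolynomial.induction_on generalizing n with
  | C c =>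
    have h1 : translate K (MvPolynomial.C c) = Polynomial.C (MvPolynomial.C c) := by
      rw [translate, MvPolynomial.aeval_C]; rfl
    rw [h1, Polynomial.coeff_C, Finset.sum_eq_zero]
    · split_ifs with h0 <;> simp [h0]
    · intro r _
      rw [perp_p, MvPolynomial.pderiv_C, smul_zero, map_zero, Polynomial.coeff_zero]
  | add f g hf hg =>
    rw [map_add, Polynomial.coeff_add, mul_add, hf, hg, ← Finset.sum_add_distrib]
    refine Finset.sum_congr rfl fun r _ => ?_
    rw [← Polynomial.coeff_add, ← map_add]
    congr 2
    exact ((perpRight (p K (Nat.succPNat r))).map_add f g).symm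
  | mul_X Q k ih =>
    change (n : Lam K) * (translate K (Q * p K k)).coeff n = ∑ r ∈ Finset.range n,
      (translate K (perp (p K (Nat.succPNat r)) (Q * p K k))).coeff (n - (r + 1))
    -- By Leibniz, p_{r+1}^⊥ either hits Q, and the translate p_k + u^k of the last factor then
    -- gives an unshifted and a shifted term, or it hits p_k, which needs r + 1 = k.
    have h1 : ∀ r ∈ Finset.range n,
        (translate K (perp (p K (Nat.succPNat r)) (Q * p K k))).coeff (n - (r + 1)) =
        (translate K (perp (p K (Nat.succPNat r)) Q)).coeff (n - (r + 1)) * p K k +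
        ((if r + 1 + k ≤ n then
          (translate K (perp (p K (Nat.succPNat r)) Q)).coeff (n - k - (r + 1)) else 0) +
        if r = (k : ℕ) - 1 then ((k : ℕ) : K) • (translate K Q).coeff (n - k) else 0) := by
      intro r hr
      have hr := Finset.mem_range.1 hr
      rw [perp_p_mul_p, map_add, Polynomial.coeff_add, translate_mul_p_coeff, add_assoc]
      have hk := k.pos
      congr 2
      · by_cases h2 : r + 1 + k ≤ n
        · rw [if_pos h2, if_pos (by omega)]
          congr 1
          omega
        · rw [if_neg h2, if_neg (by omega)]
      · have h2 : (Nat.succPNat r = k) ↔ r = (k : ℕ) - 1 := by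
          rw [← PNat.coe_inj, Nat.succPNat_coe]; omega
        by_cases h3 : r = (k : ℕ) - 1
        · rw [if_pos h3, if_pos (h2.2 h3), map_smul, Polynomial.coeff_smul]
          congr 2
          omega
        · rw [if_neg h3, if_neg (mt h2.1 h3), map_zero, Polynomial.coeff_zero]
    rw [Finset.sum_congr rfl h1, Finset.sum_add_distrib, ← Finset.sum_mul, ← ih,
      Finset.sum_add_distrib, translate_mul_p_coeff, mul_add, mul_assoc]
    congr 1
    rw [Finset.sum_ite_eq']
    have hk := k.pos
    by_cases h2 : (k : ℕ) ≤ n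
    · rw [if_pos h2, if_pos (Finset.mem_range.2 (by omega)), ← Finset.sum_filter]
      have h3 : (Finset.range n).filter (fun r => r + 1 + k ≤ n) = Finset.range (n - k) := by
        ext r; simp only [Finset.mem_filter, Finset.mem_range]; omega
      -- The shifted terms sum to (n - k) times the coefficient of u^(n-k), by induction; the term r
      -- + 1 = k supplies the missing k times it.
      rw [h3, ← ih, Nat.cast_sub h2, Algebra.smul_def]
      simp
      ring
    · rw [if_neg h2, if_neg (by simp only [Finset.mem_range]; omega), mul_zero, add_zero]
      refine (Finset.sum_eq_zero fun r _ => if_neg (by omega)).symm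

/-- Newton's recursion for h_n, passed to adjoints, is the recursion that
`natCast_mul_translate_coeff` gives for the coefficients of Q[X+u]. -/
theorem translate_coeff_eq_perp (Q : Lam K) (n : ℕ) :
    (translate K Q).coeff n = perp (h K n) Q := by
  induction n using Nat.strong_induction_on generalizing Q with
  | _ n ih =>
    cases n with
    | zero => rw [translate_coeff_zero, h, perp_one]
    | succ n =>
      refine natCast_succ_mul_cancel (K := K) n ?_
      have h1 := natCast_mul_translate_coeff Q (n + 1)
      push_cast at h1
      rw [h1]
      have h2 : ((n : Lam K) + 1) * h K (n + 1) =
          ∑ i ∈ Finset.range (n + 1), h K (n - i) * p K (Nat.succPNat i) := by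
        have := succ_mul_aeval_h_succ (K := K) (fun k => p K k) n
        have h3 : aeval (fun k => p K k) = AlgHom.id K (Lam K) := by
          refine MvPolynomial.algHom_ext fun k => ?_
          rw [MvPolynomial.aeval_X]; rfl
        rw [h3] at this
        simpa [mul_comm] using this
      have h4 : ((n : Lam K) + 1) * perp (h K (n + 1)) Q =
          perp (((n : Lam K) + 1) * h K (n + 1)) Q := by
        have h5 : ((n : Lam K) + 1) = MvPolynomial.C ((n : K) + 1) := by simp
        rw [h5, ← MvPolynomial.smul_eq_C_mul, ← MvPolynomial.smul_eq_C_mul]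
        exact ((perpLeft Q).map_smul _ _).symm
      rw [h4, h2]
      have h6 := map_sum (perpLeft Q) (fun i => h K (n - i) * p K (Nat.succPNat i))
        (Finset.range (n + 1))
      refine Eq.trans ?_ h6.symm
      refine Finset.sum_congr rfl fun i hi => ?_
      rw [ih _ (by omega)]
      rw [← perp_mul]
      rfl

end Adjoint

/-! ### Coefficient extraction, one variable at a time -/

section Extract

variable {K : Type*} [Field K]

/-- `h_n[-X]`. -/
def hNeg (K : Type*) [Field K] (n : ℕ) : Lam K := aeval (fun k => -p K k) (h K n)

/-- The coefficient of `z^n` in `Ω[-zX]` (if `mark = true`) or in `1` (if `mark = false`). -/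
def omegaCoeff (K : Type*) [Field K] (mark : Bool) (n : ℤ) : Lam K :=
  if n < 0 then 0 else if mark then hNeg K n.toNat else if n = 0 then 1 else 0

/-- A Laurent variable, together with a mark which tells whether it occurs in `Ω`, and an
exponent. -/
structure Slot where
  /-- The index of the variable. -/
  var : ℕ
  /-- Whether the variable occurs in `Ω`. -/
  mark : Bool
  /-- The exponent. -/
  exp : ℤ

/-- The coefficient of `z_v^a` in `F · Ω[-z_v X]` (or in `F`, if `v` is not marked). -/
def extract (x : Slot) : LaurentLam K →+ LaurentLam K :=
  (Finsupp.liftAddHom fun b : ℕ →₀ ℤ =>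
    (AddMonoidAlgebra.singleAddHom (b.erase x.var)).comp
      (AddMonoidHom.mulLeft (omegaCoeff K x.mark (x.exp - b x.var)))).comp
    AddMonoidAlgebra.coeffAddEquiv.toAddMonoidHom

theorem extract_single (x : Slot) (b : ℕ →₀ ℤ) (f : Lam K) :
    extract x (AddMonoidAlgebra.single b f) =
      AddMonoidAlgebra.single (b.erase x.var) (omegaCoeff K x.mark (x.exp - b x.var) * f) :=
  Finsupp.liftAddHom_apply_single _ _ _

/-- The Laurent polynomials which may be moved out of the extraction with respect to `z_v`. -/
def constSubring (K : Type*) [Field K] (v : ℕ) : Subring (LaurentLam K) where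
  carrier := {G | ∀ (mark : Bool) (e : ℤ) (F : LaurentLam K),
    extract ⟨v, mark, e⟩ (G * F) = G * extract ⟨v, mark, e⟩ F}
  mul_mem' := fun {G H} hG hH mark e F => by rw [mul_assoc, hG, hH, mul_assoc]
  one_mem' := fun mark e F => by rw [one_mul, one_mul]
  add_mem' := fun {G H} hG hH mark e F => by rw [add_mul, map_add, hG, hH, add_mul]
  zero_mem' := fun mark e F => by rw [zero_mul, map_zero, zero_mul]
  neg_mem' := fun {G} hG mark e F => by
    refine (congrArg _ (neg_mul G F)).trans ?_
    rw [map_neg, hG]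
    exact (neg_mul G (extract ⟨v, mark, e⟩ F)).symm

theorem extract_mul_of_mem (x : Slot) {G : LaurentLam K} (hG : G ∈ constSubring K x.var)
    (F : LaurentLam K) : extract x (G * F) = G * extract x F :=
  hG x.mark x.exp F

theorem single_mem_constSubring {v : ℕ} {b : ℕ →₀ ℤ} (hb : b v = 0) (f : Lam K) :
    AddMonoidAlgebra.single b f ∈ constSubring K v := by
  intro mark e F
  induction F using AddMonoidAlgebra.induction_linear with
  | zero => simp
  | add F G hF hG => rw [mul_add, map_add, hF, hG, map_add, mul_add]
  | single c g =>
    have h1 : b.erase v = b := Finsupp.erase_of_notMem_support (by simp [hb])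
    rw [AddMonoidAlgebra.single_mul_single, extract_single, extract_single,
      AddMonoidAlgebra.single_mul_single, Finsupp.erase_add, h1, Finsupp.add_apply, hb, zero_add]
    congr 1
    ring

theorem z_mem_constSubring {v i : ℕ} (hi : i ≠ v) (e : ℤ) : z K i e ∈ constSubring K v :=
  single_mem_constSubring (Finsupp.single_eq_of_ne (Ne.symm hi)) _

theorem z_mul_z (i : ℕ) (e e' : ℤ) : z K i e * z K i e' = z K i (e + e') := by
  rw [z, z, z, AddMonoidAlgebra.single_mul_single, one_mul, ← Finsupp.single_add]

theorem z_zero (i : ℕ) : z K i 0 = 1 := by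
  rw [z, Finsupp.single_zero]; rfl

theorem extract_z_mul (v : ℕ) (mark : Bool) (e s : ℤ) (F : LaurentLam K) :
    extract ⟨v, mark, e⟩ (z K v s * F) = extract ⟨v, mark, e - s⟩ F := by
  induction F using AddMonoidAlgebra.induction_linear with
  | zero => simp
  | add F G hF hG => rw [mul_add, map_add, hF, hG, map_add]
  | single c g =>
    rw [z, AddMonoidAlgebra.single_mul_single, extract_single, extract_single,
      Finsupp.erase_add, Finsupp.erase_single, zero_add, one_mul]
    simp [sub_sub]

/-- The substitution `X ↦ X + 1/z_v` in `Λ`. -/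
def shiftCoeff (K : Type*) [Field K] (v : ℕ) : Lam K →ₐ[K] LaurentLam K :=
  aeval fun k : ℕ+ => AddMonoidAlgebra.single 0 (p K k) + z K v (-(k : ℤ))

/-- The substitution `X ↦ X + 1/z_v` in Laurent polynomials over `Λ`. -/
def shift (K : Type*) [Field K] (v : ℕ) : LaurentLam K →ₐ[K] LaurentLam K :=
  AddMonoidAlgebra.liftNCAlgHom (shiftCoeff K v) (AddMonoidAlgebra.of (Lam K) (ℕ →₀ ℤ))
    fun _ _ => Commute.all _ _

theorem shift_single (v : ℕ) (b : ℕ →₀ ℤ) (f : Lam K) :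
    shift K v (AddMonoidAlgebra.single b f) =
      shiftCoeff K v f * AddMonoidAlgebra.single b 1 :=
  AddMonoidAlgebra.liftNC_single _ _ _ _

theorem shift_single_zero (v : ℕ) (f : Lam K) :
    shift K v (AddMonoidAlgebra.single 0 f) = shiftCoeff K v f := by
  rw [shift_single]
  exact mul_one _

theorem shift_z (v i : ℕ) (e : ℤ) : shift K v (z K i e) = z K i e := by
  rw [z, shift_single, map_one, one_mul]

theorem shiftCoeff_mem_constSubring {v w : ℕ} (hw : w ≠ v) (f : Lam K) :
    shiftCoeff K w f ∈ constSubring K v := by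
  induction f using MvPolynomial.induction_on with
  | C c =>
    rw [shiftCoeff, MvPolynomial.aeval_C]
    exact single_mem_constSubring (b := 0) rfl (MvPolynomial.C c)
  | add f g hf hg => rw [map_add]; exact add_mem hf hg
  | mul_X f k hf =>
    rw [map_mul]
    refine mul_mem hf ?_
    rw [shiftCoeff, MvPolynomial.aeval_X]
    exact add_mem (single_mem_constSubring rfl _) (z_mem_constSubring hw _)

/-- In h_n[-X - 1/z] = ∑ h_{n-j}[-X] h_j[-1/z] only j = 0 and j = 1 survive. -/
theorem shiftCoeff_hNeg [CharZero K] (v n : ℕ) :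
    shiftCoeff K v (hNeg K n) = AddMonoidAlgebra.single 0 (hNeg K n) -
      if n = 0 then 0 else z K v (-1) * AddMonoidAlgebra.single 0 (hNeg K (n - 1)) := by
  let a : ℕ+ → LaurentLam K := fun k => AddMonoidAlgebra.single 0 (-p K k)
  let b : ℕ+ → LaurentLam K := fun k => z K v (-1) ^ (k : ℕ) * (-1)
  have hz : ∀ k : ℕ, z K v (-1) ^ k = z K v (-(k : ℤ)) := by
    intro k
    rw [z, AddMonoidAlgebra.single_pow, one_pow, z]
    simp
  have h1 : shiftCoeff K v (hNeg K n) = aeval (a + b) (h K n) := by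
    have : (shiftCoeff K v).comp (aeval fun k => -p K k) = aeval (a + b) := by
      refine MvPolynomial.algHom_ext fun k => ?_
      simp only [AlgHom.comp_apply, MvPolynomial.aeval_X, map_neg, Pi.add_apply, a, b, hz]
      rw [p, shiftCoeff, MvPolynomial.aeval_X, AddMonoidAlgebra.single_neg, p]
      ring
    exact DFunLike.congr_fun this (h K n)
  have ha : ∀ j, aeval a (h K j) = AddMonoidAlgebra.single 0 (hNeg K j) := by
    intro j
    let ι : Lam K →ₐ[K] LaurentLam K := { AddMonoidAlgebra.singleZeroRingHom with
      commutes' := fun _ => rfl }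
    have : ι.comp (aeval fun k => -p K k) = aeval a := by
      refine MvPolynomial.algHom_ext fun k => ?_
      rw [AlgHom.comp_apply, MvPolynomial.aeval_X, MvPolynomial.aeval_X]; rfl
    exact (DFunLike.congr_fun this (h K j)).symm
  have hb : ∀ j, aeval b (h K j) = z K v (-1) ^ j *
      if j = 0 then 1 else if j = 1 then -1 else 0 := by
    intro j
    rw [← aeval_neg_one_h (K := K) j, ← aeval_h_pow_mul]
  rw [h1, aeval_h_add, Finset.Nat.sum_antidiagonal_eq_sum_range_succ_mk, Finset.sum_range_succ]
  simp only [ha, hb]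
  rcases n with _ | n
  · simp
  · rw [Finset.sum_range_succ, Finset.sum_eq_zero]
    · simp; ring
    · intro i hi
      have := Finset.mem_range.1 hi
      rw [if_neg (by omega), if_neg (by omega), mul_zero, mul_zero]

/-- With integer indices and zero for negative ones, the boundary case n = 0 of `shiftCoeff_hNeg`
needs no exception. -/
theorem shiftCoeff_omegaCoeff [CharZero K] (v : ℕ) (mark : Bool) (n : ℤ) :
    shiftCoeff K v (omegaCoeff K mark n) = AddMonoidAlgebra.single 0 (omegaCoeff K mark n) -
      if mark then z K v (-1) * AddMonoidAlgebra.single 0 (omegaCoeff K mark (n - 1)) else 0 := by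
  unfold omegaCoeff
  rcases lt_trichotomy n 0 with hn | hn | hn
  · rw [if_pos hn, if_pos (show n - 1 < 0 by omega)]
    simp
  · subst hn
    cases mark
    · simp; rfl
    · have := shiftCoeff_hNeg (K := K) v 0
      simpa using this
  · cases mark
    · simp [hn.ne']
    · have := shiftCoeff_hNeg (K := K) v n.toNat
      rw [if_neg (by omega)] at this
      rw [if_neg (show ¬ n < 0 by omega), if_neg (show ¬ n - 1 < 0 by omega)]
      simp only [if_true]
      rw [this]
      congr 5
      omega

/-- The factor which appears when `X` is replaced by `X + 1/z_v` in `Ω[-z_y X]`. -/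
def factor (K : Type*) [Field K] (v : ℕ) (y : Slot) : LaurentLam K :=
  if y.mark then 1 - z K y.var 1 * z K v (-1) else 1

/-- The substitution X ↦ X + 1/z_v also acts on the Ω[-z_y X] hidden in a marked extraction, and
Ω[-z_y(X + 1/z_v)] = (1 - z_y/z_v) Ω[-z_y X]. -/
theorem shift_extract [CharZero K] {v : ℕ} {y : Slot} (hv : v ≠ y.var) (F : LaurentLam K) :
    shift K v (extract y F) = extract y (factor K v y * shift K v F) := by
  induction F using AddMonoidAlgebra.induction_linear with
  | zero => simp
  | add F G hF hG => rw [map_add, map_add, hF, hG, map_add, mul_add, map_add]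
  | single b f =>
    rw [extract_single, shift_single, shift_single, map_mul, mul_left_comm,
      extract_mul_of_mem y (shiftCoeff_mem_constSubring hv f), shiftCoeff_omegaCoeff,
      mul_comm _ (shiftCoeff K v f), mul_assoc]
    congr 1
    obtain ⟨w, mark, e⟩ := y
    cases mark
    · simp [factor, extract_single, AddMonoidAlgebra.single_mul_single]
    -- A factor z_w under the extraction lowers the extracted exponent by one, which gives the index
    -- n - 1 of `shiftCoeff_omegaCoeff`.
    · have h1 : (1 - z K w 1 * z K v (-1)) * AddMonoidAlgebra.single b (1 : Lam K) =
          AddMonoidAlgebra.single b 1 -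
            z K v (-1) * (z K w 1 * AddMonoidAlgebra.single b (1 : Lam K)) := by ring
      simp only [factor, if_true]
      rw [h1, map_sub, extract_mul_of_mem _ (z_mem_constSubring hv _), extract_z_mul,
        extract_single, extract_single, sub_mul, mul_assoc,
        AddMonoidAlgebra.single_mul_single, AddMonoidAlgebra.single_mul_single]
      simp only [zero_add, mul_one]
      congr 4
      ring

/-- The iterated extraction with respect to the variables of a list. -/
def extractList (l : List Slot) (F : LaurentLam K) : LaurentLam K :=
  l.foldr (fun y G => extract y G) F

theorem extractList_cons (x : Slot) (l : List Slot) (F : LaurentLam K) :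
    extractList (x :: l) F = extract x (extractList l F) := rfl

theorem extractList_append (l l' : List Slot) (F : LaurentLam K) :
    extractList (l ++ l') F = extractList l (extractList l' F) := List.foldr_append

theorem extractList_mul_of_mem (l : List Slot) {G : LaurentLam K}
    (hG : ∀ y ∈ l, G ∈ constSubring K y.var) (F : LaurentLam K) :
    extractList l (G * F) = G * extractList l F := by
  induction l with
  | nil => rfl
  | cons x l ih =>
    rw [extractList_cons, ih fun y hy => hG y (List.mem_cons_of_mem _ hy),
      extract_mul_of_mem x (hG x List.mem_cons_self), extractList_cons]

/-- `extractList` as an additive map. -/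
def extractListHom (K : Type*) [Field K] (l : List Slot) : LaurentLam K →+ LaurentLam K :=
  l.foldr (fun y f => (extract y).comp f) (AddMonoidHom.id _)

theorem extractListHom_apply (l : List Slot) (F : LaurentLam K) :
    extractListHom K l F = extractList l F := by
  induction l with
  | nil => rfl
  | cons x l ih => rw [extractList_cons, ← ih]; rfl

theorem factor_mem_constSubring {v w : ℕ} {y : Slot} (hv : v ≠ w) (hy : y.var ≠ w) :
    factor K v y ∈ constSubring K w := by
  unfold factor
  split_ifs
  · exact sub_mem (one_mem _)
      (mul_mem (z_mem_constSubring hy _) (z_mem_constSubring hv _))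
  · exact one_mem _

theorem shift_extractList [CharZero K] (v : ℕ) (l : List Slot)
    (hl : (v :: l.map Slot.var).Nodup) (F : LaurentLam K) :
    shift K v (extractList l F) =
      extractList l ((l.map (factor K v)).prod * shift K v F) := by
  induction l with
  | nil => simp [extractList]
  | cons y l ih =>
    simp only [List.map_cons, List.nodup_cons, List.mem_cons, not_or] at hl
    obtain ⟨⟨h1, h2⟩, h3, h4⟩ := hl
    rw [extractList_cons, shift_extract h1, ih (List.nodup_cons.2 ⟨h2, h4⟩), extractList_cons,
      ← extractList_mul_of_mem l, List.map_cons, List.prod_cons, mul_assoc]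
    intro w hw
    refine factor_mem_constSubring ?_ ?_
    · exact fun h0 => h2 (h0 ▸ List.mem_map_of_mem hw)
    · exact fun h0 => h3 (h0 ▸ List.mem_map_of_mem hw)

/-- The operator `P ↦ P[X + 1/z] Ω[-zX] |_{z^a}` (or `P ↦ P[X + 1/z] |_{z^a}`). -/
def slotOp (x : Slot) (Q : Lam K) : Lam K :=
  (translate K Q).sum fun n c => omegaCoeff K x.mark (x.exp + n) * c

theorem shiftCoeff_eq_sum (v : ℕ) (Q : Lam K) :
    shiftCoeff K v Q = (translate K Q).sum fun n c =>
      AddMonoidAlgebra.single (Finsupp.single v (-(n : ℤ))) c := by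
  let ι : Lam K →ₐ[K] LaurentLam K := { AddMonoidAlgebra.singleZeroRingHom with
    commutes' := fun _ => rfl }
  have hz : ∀ k : ℕ, z K v (-1) ^ k = z K v (-(k : ℤ)) := by
    intro k
    rw [z, AddMonoidAlgebra.single_pow, one_pow, z]
    simp
  have h1 : shiftCoeff K v Q = (translate K Q).eval₂ ι.toRingHom (z K v (-1)) := by
    induction Q using MvPolynomial.induction_on with
    | C c =>
      rw [shiftCoeff, translate, MvPolynomial.aeval_C, MvPolynomial.aeval_C]
      exact (Polynomial.eval₂_C ι.toRingHom (z K v (-1)) (a := MvPolynomial.C c)).symm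
    | add f g hf hg => rw [map_add, map_add, Polynomial.eval₂_add, hf, hg]
    | mul_X f k hf =>
      rw [map_mul, map_mul, Polynomial.eval₂_mul, hf]
      congr 1
      rw [shiftCoeff, translate, MvPolynomial.aeval_X, MvPolynomial.aeval_X, Polynomial.eval₂_add,
        Polynomial.eval₂_C, Polynomial.eval₂_X_pow, hz]
      rfl
  rw [h1, Polynomial.eval₂_eq_sum]
  unfold Polynomial.sum
  refine Finset.sum_congr rfl fun n _ => ?_
  change AddMonoidAlgebra.single 0 _ * z K v (-1) ^ n = _
  rw [hz]
  rw [z, AddMonoidAlgebra.single_mul_single, zero_add, mul_one]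

/-- The variable u of `translate` is 1/z_v: the term u^n contributes z_v^(-n), so Ω has to supply
the exponent e + n. -/
theorem extract_shift_single_zero (x : Slot) (Q : Lam K) :
    extract x (shift K x.var (AddMonoidAlgebra.single 0 Q)) =
      AddMonoidAlgebra.single 0 (slotOp x Q) := by
  rw [shift_single_zero, shiftCoeff_eq_sum, slotOp, Polynomial.sum, map_sum, Polynomial.sum]
  have h1 := map_sum (AddMonoidAlgebra.singleAddHom (0 : ℕ →₀ ℤ) : Lam K →+ LaurentLam K)
    (fun n : ℕ => omegaCoeff K x.mark (x.exp + n) * (translate K Q).coeff n) (translate K Q).support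
  refine Eq.trans ?_ h1.symm
  refine Finset.sum_congr rfl fun n _ => ?_
  rw [extract_single, Finsupp.erase_single]
  simp

/-- The alphabet `X + ∑ 1/z_v`, the sum over the variables of a list of slots. -/
def alphabet (K : Type*) [Field K] (l : List Slot) : LaurentLam K :=
  X K + (l.map fun y => z K y.var (-1)).sum

theorem powerSub_single (k : ℕ+) (b : ℕ →₀ ℤ) (f : Lam K) :
    powerSub K k (AddMonoidAlgebra.single b f) =
      AddMonoidAlgebra.single ((k : ℕ) • b) (aeval (fun j : ℕ+ => p K (k * j)) f) := by
  rw [powerSub, RingHom.comp_apply, AddMonoidAlgebra.mapRingHom_single,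
    AddMonoidAlgebra.mapDomainRingHom_apply, AddMonoidAlgebra.mapDomain_single]
  rfl

theorem powerSub_z (k : ℕ+) (i : ℕ) (e : ℤ) : powerSub K k (z K i e) = z K i (k * e) := by
  rw [z, powerSub_single, map_one, z, Finsupp.smul_single]
  simp

theorem powerSub_X (k : ℕ+) : powerSub K k (X K) = AddMonoidAlgebra.single 0 (p K k) := by
  rw [X, powerSub_single, p, MvPolynomial.aeval_X, mul_one, smul_zero]

theorem pleth_alphabet_cons (P : Lam K) (x : Slot) (l : List Slot) :
    pleth P (alphabet K (x :: l)) = shift K x.var (pleth P (alphabet K l)) := by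
  have h1 : aeval (fun k : ℕ+ => powerSub K k (alphabet K (x :: l))) =
      (shift K x.var).comp (aeval fun k : ℕ+ => powerSub K k (alphabet K l)) := by
    refine MvPolynomial.algHom_ext fun k => ?_
    rw [AlgHom.comp_apply, MvPolynomial.aeval_X, MvPolynomial.aeval_X]
    simp only [alphabet, map_add, powerSub_X, shift_single_zero, map_list_sum, List.map_map,
      List.map_cons, List.sum_cons, Function.comp_def, powerSub_z, shift_z]
    rw [shiftCoeff, p, MvPolynomial.aeval_X, p]
    simp [add_assoc]
  exact DFunLike.congr_fun h1 P

theorem pleth_alphabet_nil (P : Lam K) :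
    pleth P (alphabet K []) = AddMonoidAlgebra.single 0 P := by
  let ι : Lam K →ₐ[K] LaurentLam K := { AddMonoidAlgebra.singleZeroRingHom with
    commutes' := fun _ => rfl }
  have h1 : aeval (fun k : ℕ+ => powerSub K k (alphabet K [])) = ι := by
    refine MvPolynomial.algHom_ext fun k => ?_
    rw [MvPolynomial.aeval_X]
    simp only [alphabet, List.map_nil, List.sum_nil, add_zero, powerSub_X]
    rfl
  exact DFunLike.congr_fun h1 P

/-- The product of the factors `1 - z_j/z_i` for `i` before `j` in the list, `j` marked. -/
def markedPairs (K : Type*) [Field K] : List Slot → LaurentLam K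
  | [] => 1
  | x :: l => (l.map (factor K x.var)).prod * markedPairs K l

theorem shift_factor (v w : ℕ) (y : Slot) : shift K v (factor K w y) = factor K w y := by
  unfold factor
  split_ifs
  · rw [map_sub, map_mul, shift_z, shift_z, map_one]
  · rw [map_one]

theorem shift_markedPairs (v : ℕ) (l : List Slot) :
    shift K v (markedPairs K l) = markedPairs K l := by
  induction l with
  | nil => exact map_one _
  | cons x l ih =>
    rw [markedPairs, map_mul, ih, map_list_prod, List.map_map]
    simp only [Function.comp_def, shift_factor]

/-- Each outer operator shifts X through all the extractions inside it, collecting one factor per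
inner marked slot, and enlarges the alphabet by 1/z_v. -/
theorem foldr_slotOp [CharZero K] (l : List Slot) (hl : (l.map Slot.var).Nodup) (P : Lam K) :
    AddMonoidAlgebra.single 0 (l.foldr slotOp P) =
      extractList l (markedPairs K l * pleth P (alphabet K l)) := by
  induction l with
  | nil =>
    rw [pleth_alphabet_nil, markedPairs, one_mul]
    rfl
  | cons x l ih =>
    rw [List.foldr_cons, ← extract_shift_single_zero,
      ih (List.nodup_cons.1 hl).2, shift_extractList _ _ hl, map_mul, shift_markedPairs,
      ← pleth_alphabet_cons, extractList_cons, markedPairs, mul_assoc]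

end Extract

/-! ### Comparison of `coeffOmega` with iterated extraction -/

section CoeffOmega

variable {K : Type*} [Field K]

/-- The sum of the marked variables of a list. -/
def markedSum (K : Type*) [Field K] (l : List Slot) : LaurentLam K :=
  (l.map fun y => if y.mark then z K y.var 1 else 0).sum

theorem ZHomogeneous.neg {F : LaurentLam K} {n : ℤ} (hF : ZHomogeneous F n) :
    ZHomogeneous (-F) n := by
  intro a ha
  refine hF a fun h0 => ha ?_
  rw [AddMonoidAlgebra.coeff_neg, Finsupp.neg_apply, h0, neg_zero]

theorem zHomogeneous_z (i : ℕ) (e : ℤ) : ZHomogeneous (z K i e) e := by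
  classical
  intro a ha
  rw [z, AddMonoidAlgebra.coeff_single] at ha
  by_cases h0 : a = Finsupp.single i e
  · simp [h0]
  · exact absurd (Finsupp.single_eq_of_ne h0) ha

theorem zHomogeneous_X : ZHomogeneous (X K) 0 := by
  classical
  intro a ha
  rw [X, AddMonoidAlgebra.coeff_single] at ha
  by_cases h0 : a = 0
  · simp [h0]
  · exact absurd (Finsupp.single_eq_of_ne h0) ha

theorem zHomogeneous_markedSum (l : List Slot) : ZHomogeneous (markedSum K l) 1 := by
  induction l with
  | nil => intro a ha; exact absurd rfl ha
  | cons x l ih =>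
    intro a ha
    rw [markedSum, List.map_cons, List.sum_cons, AddMonoidAlgebra.coeff_add,
      Finsupp.add_apply] at ha
    by_cases h0 : (markedSum K l).coeff a = 0
    · change _ + (markedSum K l).coeff a ≠ 0 at ha
      rw [h0, add_zero] at ha
      split_ifs at ha with hx
      · exact zHomogeneous_z _ _ a ha
      · exact absurd rfl ha
    · exact ih a h0

theorem zHomogeneous_neg_markedSum_mul_X (l : List Slot) :
    ZHomogeneous (-markedSum K l * X K) 1 := by
  have := (zHomogeneous_markedSum (K := K) l).neg.mul zHomogeneous_X
  rwa [add_zero] at this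

theorem coeffOmega_add {E : LaurentLam K} (hE : ZHomogeneous E 1) (F G : LaurentLam K)
    (a : ℕ →₀ ℤ) : coeffOmega (F + G) E a = coeffOmega F E a + coeffOmega G E a := by
  unfold coeffOmega
  rw [← finsum_add_distrib (coeffOmega_finite F E hE a) (coeffOmega_finite G E hE a)]
  refine finsum_congr fun n => ?_
  rw [add_mul, AddMonoidAlgebra.coeff_add, Finsupp.add_apply]

theorem omegaCoeff_of_neg (mark : Bool) {n : ℤ} (hn : n < 0) : omegaCoeff K mark n = 0 :=
  if_pos hn

theorem degree_erase (c : ℕ →₀ ℤ) (v : ℕ) : (c.erase v).degree = c.degree - c v := by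
  have h1 := congrArg Finsupp.degree (Finsupp.single_add_erase v c)
  rw [map_add, Finsupp.degree_single] at h1
  omega

theorem extractList_single (l : List Slot) (hl : (l.map Slot.var).Nodup) (b : ℕ →₀ ℤ)
    (f : Lam K) :
    extractList l (AddMonoidAlgebra.single b f) =
      AddMonoidAlgebra.single (b.filter fun i => i ∉ l.map Slot.var)
        ((l.map fun y => omegaCoeff K y.mark (y.exp - b y.var)).prod * f) := by
  induction l with
  | nil =>
    have h1 : b.filter (fun i => i ∉ ([] : List Slot).map Slot.var) = b := by
      ext i
      rw [Finsupp.filter_apply]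
      simp
    rw [h1]
    simp [extractList]
  | cons x l ih =>
    have hx : x.var ∉ l.map Slot.var := (List.nodup_cons.1 hl).1
    rw [extractList_cons, ih (List.nodup_cons.1 hl).2, extract_single,
      Finsupp.filter_apply_pos (fun i => i ∉ l.map Slot.var) b hx, List.map_cons, List.map_cons,
      List.prod_cons, mul_assoc]
    congr 1
    ext i
    by_cases hi : i = x.var
    · subst hi
      simp
    · rw [Finsupp.erase_ne hi, Finsupp.filter_apply, Finsupp.filter_apply]
      simp [hi]

theorem sum_single_apply_of_notMem (l : List Slot) {i : ℕ} (hi : i ∉ l.map Slot.var) :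
    ((l.map fun y => Finsupp.single y.var y.exp).sum : ℕ →₀ ℤ) i = 0 := by
  induction l with
  | nil => rfl
  | cons x l ih =>
    rw [List.map_cons, List.mem_cons, not_or] at hi
    rw [List.map_cons, List.sum_cons, Finsupp.add_apply, ih hi.2,
      Finsupp.single_eq_of_ne hi.1, add_zero]

theorem sum_single_apply_of_mem (l : List Slot) (hl : (l.map Slot.var).Nodup) {y : Slot}
    (hy : y ∈ l) : ((l.map fun y => Finsupp.single y.var y.exp).sum : ℕ →₀ ℤ) y.var = y.exp := by
  induction l with
  | nil => simp at hy
  | cons x l ih =>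
    have hx : x.var ∉ l.map Slot.var := (List.nodup_cons.1 hl).1
    rw [List.map_cons, List.sum_cons, Finsupp.add_apply]
    rcases List.mem_cons.1 hy with rfl | hy
    · rw [sum_single_apply_of_notMem l hx, Finsupp.single_eq_same, add_zero]
    · rw [ih (List.nodup_cons.1 hl).2 hy, Finsupp.single_eq_of_ne, zero_add]
      exact fun h0 => hx (h0 ▸ List.mem_map_of_mem hy)

variable [CharZero K]

theorem pleth_h_neg_z_mul_X (v n : ℕ) :
    pleth (h K n) (-z K v 1 * X K) =
      AddMonoidAlgebra.single (Finsupp.single v (n : ℤ)) (hNeg K n) := by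
  let ι : Lam K →ₐ[K] LaurentLam K := { AddMonoidAlgebra.singleZeroRingHom with
    commutes' := fun _ => rfl }
  have hz : ∀ k : ℕ, z K v 1 ^ k = z K v k := by
    intro k
    rw [z, AddMonoidAlgebra.single_pow, one_pow, z]
    simp
  have h1 : (fun k : ℕ+ => powerSub K k (-z K v 1 * X K)) =
      fun k : ℕ+ => z K v 1 ^ (k : ℕ) * ι (-p K k) := by
    funext k
    rw [map_mul, map_neg, powerSub_z, powerSub_X, map_neg, hz, mul_one]
    change -z K v k * AddMonoidAlgebra.single 0 (p K k) =
      z K v k * -AddMonoidAlgebra.single 0 (p K k)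
    ring
  have h2 : aeval (fun k : ℕ+ => ι (-p K k)) = ι.comp (aeval fun k : ℕ+ => -p K k) := by
    refine MvPolynomial.algHom_ext fun k => ?_
    rw [AlgHom.comp_apply, MvPolynomial.aeval_X, MvPolynomial.aeval_X]
  rw [pleth, h1, aeval_h_pow_mul, h2, hz, AlgHom.comp_apply]
  change z K v n * AddMonoidAlgebra.single 0 (hNeg K n) = _
  rw [z, AddMonoidAlgebra.single_mul_single, add_zero, one_mul]

theorem pleth_h_zero (n : ℕ) :
    pleth (h K n) (0 : LaurentLam K) = if n = 0 then 1 else 0 := by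
  rw [← aeval_h_zero_fun (K := K), pleth]
  congr 2

theorem pleth_h_add (E E' : LaurentLam K) (n : ℕ) :
    pleth (h K n) (E + E') = ∑ ij ∈ Finset.HasAntidiagonal.antidiagonal n,
      pleth (h K ij.1) E * pleth (h K ij.2) E' := by
  unfold pleth
  rw [← aeval_h_add]
  congr 2
  funext k
  exact map_add _ _ _

theorem pleth_h_slot (x : Slot) (n : ℕ) :
    pleth (h K n) (-(if x.mark then z K x.var 1 else 0) * X K) =
      AddMonoidAlgebra.single (Finsupp.single x.var (n : ℤ)) (omegaCoeff K x.mark n) := by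
  obtain ⟨v, mark, e⟩ := x
  cases mark
  · simp only [Bool.false_eq_true, if_false, neg_zero, zero_mul, pleth_h_zero, omegaCoeff]
    rcases n with _ | n
    · simp; rfl
    · rw [if_neg (by omega), if_neg (by omega), if_neg (by omega), AddMonoidAlgebra.single_zero]
  · simp only [if_true, pleth_h_neg_z_mul_X, omegaCoeff]
    rw [if_neg (by omega), Int.toNat_natCast]

open Classical in
-- Ω[-(z_1 + ⋯)X] is the product of the Ω[-z_i X] over the marked slots, and h_n picks out its part
-- of degree n in the z_i.
theorem coeff_pleth_h_markedSum (l : List Slot) (hl : (l.map Slot.var).Nodup) (n : ℕ)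
    (c : ℕ →₀ ℤ) :
    (pleth (h K n) (-markedSum K l * X K)).coeff c =
      if c.degree = n ∧ ∀ i, i ∉ l.map Slot.var → c i = 0 then
        (l.map fun y => omegaCoeff K y.mark (c y.var)).prod else 0 := by
  induction l generalizing n c with
  | nil =>
    have h1 : -markedSum K [] * X K = 0 := by simp [markedSum]
    rw [h1, pleth_h_zero]
    by_cases hc : c = 0
    · subst hc
      rcases n with _ | n
      · simp
      · rw [if_neg (by omega), if_neg]
        · rfl
        · rintro ⟨h2, -⟩
          rw [map_zero] at h2
          omega
    · have h2 : ¬ ∀ i, i ∉ ([] : List Slot).map Slot.var → c i = 0 := by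
        intro h2
        exact hc (Finsupp.ext fun i => h2 i (by simp))
      refine Eq.trans ?_ (if_neg fun h3 => h2 h3.2).symm
      split_ifs
      · rw [AddMonoidAlgebra.one_def, AddMonoidAlgebra.coeff_single, Finsupp.single_eq_of_ne hc]
      · rfl
  | cons x l ih =>
    have hx : x.var ∉ l.map Slot.var := (List.nodup_cons.1 hl).1
    have hl' := (List.nodup_cons.1 hl).2
    have h1 : -markedSum K (x :: l) * X K =
        -(if x.mark then z K x.var 1 else 0) * X K + -markedSum K l * X K := by
      rw [markedSum, List.map_cons, List.sum_cons, markedSum]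
      ring
    rw [h1, pleth_h_add, AddMonoidAlgebra.coeff_sum, Finsupp.finsetSum_apply]
    -- The exponent of the first variable in z^c determines how n is split, so at most one pair
    -- contributes.
    have h2 : ∀ ij ∈ Finset.HasAntidiagonal.antidiagonal n,
        (pleth (h K ij.1) (-(if x.mark then z K x.var 1 else 0) * X K) *
          pleth (h K ij.2) (-markedSum K l * X K)).coeff c =
        if c x.var = ij.1 ∧ c.degree = n ∧ ∀ i, i ∉ (x :: l).map Slot.var → c i = 0 then
          ((x :: l).map fun y => omegaCoeff K y.mark (c y.var)).prod else 0 := by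
      intro ij hij
      have hij := Finset.HasAntidiagonal.mem_antidiagonal.1 hij
      rw [pleth_h_slot, AddMonoidAlgebra.coeff_single_mul_apply, ih hl']
      by_cases h3 : c x.var = ij.1
      · have h4 : -Finsupp.single x.var (ij.1 : ℤ) + c = c.erase x.var := by
          conv_lhs => rw [← Finsupp.single_add_erase x.var c, h3]
          simp
        rw [h4, degree_erase, h3]
        have h5 : (l.map fun y => omegaCoeff K y.mark ((c.erase x.var) y.var)) =
            l.map fun y => omegaCoeff K y.mark (c y.var) := by
          refine List.map_congr_left fun y hy => ?_
          rw [Finsupp.erase_ne]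
          exact fun h0 => hx (h0 ▸ List.mem_map_of_mem hy)
        rw [h5, mul_ite, mul_zero]
        simp only [List.map_cons, List.prod_cons, h3]
        refine if_congr ?_ rfl rfl
        rw [true_and]
        refine and_congr (by omega) (forall_congr' fun i => ?_)
        by_cases hi : i = x.var
        · subst hi; simp
        · rw [Finsupp.erase_ne hi, List.mem_cons, not_or]
          tauto
      · refine Eq.trans ?_ (if_neg fun h4 => h3 h4.1).symm
        rw [if_neg, mul_zero]
        rintro ⟨-, h4⟩
        have := h4 x.var hx
        rw [Finsupp.add_apply, Finsupp.neg_apply, Finsupp.single_eq_same] at this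
        omega
    rw [Finset.sum_congr rfl h2]
    by_cases h3 : c.degree = n ∧ ∀ i, i ∉ (x :: l).map Slot.var → c i = 0
    · rw [if_pos h3]
      simp only [fun A : Prop => (and_iff_left h3 : (A ∧ _) ↔ A)]
      by_cases h4 : ∃ ij ∈ Finset.HasAntidiagonal.antidiagonal n, c x.var = (ij.1 : ℕ)
      · obtain ⟨ij, hij, h5⟩ := h4
        rw [Finset.sum_eq_single_of_mem ij hij, if_pos]
        · exact h5
        · intro ij' hij' hne
          refine if_neg fun h6 => hne ?_
          have h7 := Finset.HasAntidiagonal.mem_antidiagonal.1 hij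
          have h8 := Finset.HasAntidiagonal.mem_antidiagonal.1 hij'
          have h9 : c x.var = ij'.1 := h6
          refine Prod.ext ?_ ?_ <;> omega
      · rw [Finset.sum_eq_zero]
        -- No split fits, so this exponent is negative or exceeds n. In the second case the total
        -- degree n forces another exponent to be negative. Either way the product has a zero
        -- factor.
        · rcases lt_or_ge (c x.var) 0 with h5 | h5
          · rw [List.map_cons, List.prod_cons, omegaCoeff_of_neg _ h5, zero_mul]
          · have h6 : (n : ℤ) < c x.var := by
              by_contra h6
              refine h4 ⟨((c x.var).toNat, n - (c x.var).toNat), ?_, ?_⟩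
              · rw [Finset.HasAntidiagonal.mem_antidiagonal]; omega
              · simp [h5]
            have h7 : (c.erase x.var).degree < 0 := by rw [degree_erase]; omega
            have h8 : ∃ y ∈ l, c y.var < 0 := by
              by_contra! h8
              refine absurd h7 (not_lt.2 ?_)
              rw [Finsupp.degree_apply]
              refine Finset.sum_nonneg fun i _ => ?_
              by_cases hi : i = x.var
              · subst hi; simp
              · rw [Finsupp.erase_ne hi]
                by_cases hi' : i ∈ l.map Slot.var
                · obtain ⟨y, hy, rfl⟩ := List.mem_map.1 hi'
                  exact h8 y hy
                · rw [h3.2 i (by simp [hi]; simpa using hi')]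
            obtain ⟨y, hy, h9⟩ := h8
            symm
            refine List.prod_eq_zero (List.mem_map.2 ⟨y, List.mem_cons_of_mem _ hy, ?_⟩)
            exact omegaCoeff_of_neg _ h9
        · intro ij hij
          exact if_neg fun h5 => h4 ⟨ij, hij, h5⟩
    · rw [if_neg h3]
      exact Finset.sum_eq_zero fun ij _ => if_neg fun h4 => h3 h4.2

/-- By additivity F may be a single term f z^b. Then only n = deg(a - b) counts, and the coefficient
of z^(a-b) in Ω factors over the slots. -/
theorem coeffOmega_eq_extractList (l : List Slot) (hl : (l.map Slot.var).Nodup)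
    (F : LaurentLam K) :
    coeffOmega F (-markedSum K l * X K) (l.map fun y => Finsupp.single y.var y.exp).sum =
      (extractList l F).coeff 0 := by
  classical
  induction F using AddMonoidAlgebra.induction_linear with
  | zero =>
    rw [← extractListHom_apply, map_zero (extractListHom K l), coeffOmega]
    refine finsum_eq_zero_of_forall_eq_zero fun n => ?_
    rw [zero_mul]; rfl
  | add F G hF hG =>
    rw [coeffOmega_add (zHomogeneous_neg_markedSum_mul_X l), hF, hG, ← extractListHom_apply,
      ← extractListHom_apply, ← extractListHom_apply, map_add]
    rfl
  | single b f =>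
    set a : ℕ →₀ ℤ := (l.map fun y => Finsupp.single y.var y.exp).sum with ha
    rw [extractList_single l hl, coeffOmega, AddMonoidAlgebra.coeff_single]
    have h1 : (l.map fun y => omegaCoeff K y.mark ((-b + a) y.var)) =
        l.map fun y => omegaCoeff K y.mark (y.exp - b y.var) := by
      refine List.map_congr_left fun y hy => ?_
      rw [Finsupp.add_apply, Finsupp.neg_apply, ha, sum_single_apply_of_mem l hl hy]
      congr 1
      ring
    have h2 : (∀ i, i ∉ l.map Slot.var → (-b + a) i = 0) ↔
        b.filter (fun i => i ∉ l.map Slot.var) = 0 := by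
      rw [Finsupp.filter_eq_zero_iff]
      refine forall_congr' fun i => forall_congr' fun hi => ?_
      rw [Finsupp.add_apply, Finsupp.neg_apply, ha, sum_single_apply_of_notMem l hi]
      omega
    have h3 : ∀ n : ℕ, (AddMonoidAlgebra.single b f *
        pleth (h K n) (-markedSum K l * X K)).coeff a =
        if (-b + a).degree = n ∧ b.filter (fun i => i ∉ l.map Slot.var) = 0 then
          f * (l.map fun y => omegaCoeff K y.mark (y.exp - b y.var)).prod else 0 := by
      intro n
      rw [AddMonoidAlgebra.coeff_single_mul_apply, coeff_pleth_h_markedSum l hl, h1, mul_ite,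
        mul_zero]
      exact if_congr (and_congr Iff.rfl h2) rfl rfl
    rw [finsum_congr h3]
    by_cases h4 : b.filter (fun i => i ∉ l.map Slot.var) = 0
    · rw [h4, Finsupp.single_eq_same, mul_comm _ f]
      by_cases h5 : 0 ≤ (-b + a).degree
      · rw [finsum_eq_single _ (-b + a).degree.toNat, if_pos ⟨by omega, rfl⟩]
        intro n hn
        exact if_neg fun h6 => hn (by omega)
      -- If deg(a - b) < 0 no n contributes; the extraction vanishes too, because some exponent is
      -- negative.
      · have h6 : ∃ y ∈ l, (-b + a) y.var < 0 := by
          by_contra! h6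
          refine h5 ?_
          rw [Finsupp.degree_apply]
          refine Finset.sum_nonneg fun i _ => ?_
          by_cases hi : i ∈ l.map Slot.var
          · obtain ⟨y, hy, rfl⟩ := List.mem_map.1 hi
            exact h6 y hy
          · rw [h2.2 h4 i hi]
        obtain ⟨y, hy, h7⟩ := h6
        rw [← h1, List.prod_eq_zero (List.mem_map.2 ⟨y, hy, omegaCoeff_of_neg _ h7⟩), mul_zero]
        refine finsum_eq_zero_of_forall_eq_zero fun n => ?_
        exact ite_self _
    · rw [Finsupp.single_eq_of_ne (Ne.symm h4)]
      exact finsum_eq_zero_of_forall_eq_zero fun n => if_neg fun h6 => h4 h6.2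

end CoeffOmega

/-! ### The creation operators and the adjoints as slot operators -/

section Operators

variable {K : Type*} [Field K]

theorem coeff_single_zero_zero (f : Lam K) :
    (AddMonoidAlgebra.single 0 f : LaurentLam K).coeff 0 = f := Finsupp.single_eq_same

/-- The involution `ω` on the coefficients, combined with `z_i ↦ -z_i`. -/
def signedOmega (K : Type*) [Field K] : LaurentLam K →ₐ[K] LaurentLam K :=
  AddMonoidAlgebra.liftNCAlgHom
    ((({ AddMonoidAlgebra.singleZeroRingHom with
      commutes' := fun _ => rfl } : Lam K →ₐ[K] LaurentLam K)).comp (omega K))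
    { toFun := fun b => AddMonoidAlgebra.single b.toAdd
        (((b.toAdd.degree.negOnePow : ℤˣ) : ℤ) : Lam K)
      map_one' := by simp; rfl
      map_mul' := fun b c => by
        rw [AddMonoidAlgebra.single_mul_single, toAdd_mul, map_add, Int.negOnePow_add]
        push_cast
        rfl }
    fun _ _ => Commute.all _ _

theorem signedOmega_single (b : ℕ →₀ ℤ) (f : Lam K) :
    signedOmega K (AddMonoidAlgebra.single b f) =
      AddMonoidAlgebra.single b (((b.degree.negOnePow : ℤˣ) : ℤ) * omega K f) := by
  refine (AddMonoidAlgebra.liftNC_single _ _ _ _).trans ?_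
  change AddMonoidAlgebra.single 0 (omega K f) * AddMonoidAlgebra.single b _ = _
  rw [AddMonoidAlgebra.single_mul_single, zero_add, mul_comm]
  rfl

theorem coeff_signedOmega (F : LaurentLam K) (a : ℕ →₀ ℤ) :
    (signedOmega K F).coeff a = ((a.degree.negOnePow : ℤˣ) : ℤ) * omega K (F.coeff a) := by
  classical
  induction F using AddMonoidAlgebra.induction_linear with
  | zero => simp
  | add F G hF hG =>
    rw [map_add, AddMonoidAlgebra.coeff_add, Finsupp.add_apply, hF, hG,
      AddMonoidAlgebra.coeff_add, Finsupp.add_apply, map_add, mul_add]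
  | single b f =>
    rw [signedOmega_single, AddMonoidAlgebra.coeff_single, AddMonoidAlgebra.coeff_single]
    by_cases hab : a = b
    · subst hab; rw [Finsupp.single_eq_same, Finsupp.single_eq_same]
    · rw [Finsupp.single_eq_of_ne hab, Finsupp.single_eq_of_ne hab, map_zero, mul_zero]

theorem negOnePow_mul_self (n : ℤ) :
    (((n.negOnePow : ℤˣ) : ℤ) : Lam K) * ((n.negOnePow : ℤˣ) : ℤ) = 1 := by
  rw [← Int.cast_mul, ← Units.val_mul, ← Int.negOnePow_add, Int.negOnePow_even _ ⟨n, rfl⟩]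
  simp

theorem omega_coeffOmega {F E : LaurentLam K} (hE : ZHomogeneous E 1) (a : ℕ →₀ ℤ)
    {E' : LaurentLam K} (hE' : ∀ n, signedOmega K (pleth (h K n) E) = pleth (h K n) E') :
    omega K (coeffOmega F E a) =
      ((a.degree.negOnePow : ℤˣ) : ℤ) * coeffOmega (signedOmega K F) E' a := by
  have h1 : ∀ n : ℕ, omega K ((F * pleth (h K n) E).coeff a) =
      ((a.degree.negOnePow : ℤˣ) : ℤ) * (signedOmega K F * pleth (h K n) E').coeff a := by
    intro n
    rw [← hE', ← map_mul, coeff_signedOmega, ← mul_assoc, negOnePow_mul_self, one_mul]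
  have h2 : (Function.support fun n : ℕ => (F * pleth (h K n) E).coeff a).Finite :=
    coeffOmega_finite F E hE a
  have h3 := AddMonoidHom.map_finsum (omega K : Lam K →ₐ[K] Lam K).toRingHom.toAddMonoidHom h2
  refine (h3.trans (finsum_congr h1)).trans ?_
  rw [coeffOmega]
  refine (AddMonoidHom.map_finsum_of_injective (AddMonoidHom.mulLeft
    ((((a.degree.negOnePow : ℤˣ) : ℤ) : Lam K))) (fun x y hxy => ?_) _).symm
  have hxy' : (((a.degree.negOnePow : ℤˣ) : ℤ) : Lam K) * x =
      ((a.degree.negOnePow : ℤˣ) : ℤ) * y := hxy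
  have h4 := congrArg (fun w => (((a.degree.negOnePow : ℤˣ) : ℤ) : Lam K) * w) hxy'
  simpa only [← mul_assoc, negOnePow_mul_self, one_mul] using h4

theorem omega_p (k : ℕ+) : omega K (p K k) = (-1) ^ ((k : ℕ) - 1) * p K k :=
  MvPolynomial.aeval_X _ _

variable [CharZero K]

/-- ω followed by z ↦ -z sends z^k p_k to -z^k p_k, so Ω[zX] becomes Ω[-zX]; with the inner ω it
turns P[X - 1/z] into P[X + 1/z]. The coefficient of z^n picks up (-1)^n. The name `v` of the
variable is free, so later each column can use its position in the ribbon. -/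
theorem Stilde_eq_slotOp (v n : ℕ) (P : Lam K) :
    Stilde (n : ℤ) P = (-1) ^ n * slotOp ⟨v, true, n⟩ P := by
  let x : Slot := ⟨1, true, n⟩
  have hneg : ∀ k : ℕ, ((((k : ℤ).negOnePow : ℤˣ) : ℤ) : Lam K) = (-1) ^ k := by
    intro k
    rw [Int.negOnePow_def]
    simp
  have hneg' : ∀ k : ℕ, (((-(k : ℤ)).negOnePow : ℤˣ) : ℤ) = (((k : ℤ).negOnePow : ℤˣ) : ℤ) := by
    intro k
    rw [Int.negOnePow_neg]
  have hsq : ∀ k : ℕ, ((-1 : Lam K) ^ k) * (-1) ^ k = 1 := by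
    intro k
    rw [← mul_pow]; simp
  have hk : ∀ k : ℕ+, (-1 : Lam K) ^ (k : ℕ) = -(-1) ^ ((k : ℕ) - 1) := by
    intro k
    conv_lhs => rw [← Nat.sub_add_cancel k.pos, pow_succ, mul_neg_one]
  have hzX : ∀ k : ℕ+, z K 1 k * AddMonoidAlgebra.single 0 (p K k) =
      AddMonoidAlgebra.single (Finsupp.single 1 (k : ℤ)) (p K k) := by
    intro k
    rw [z, AddMonoidAlgebra.single_mul_single, add_zero, one_mul]
  have h1 : ∀ m, signedOmega K (pleth (h K m) (z K 1 1 * X K)) =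
      pleth (h K m) (-markedSum K [x] * X K) := by
    intro m
    have : (signedOmega K).comp (aeval fun k => powerSub K k (z K 1 1 * X K)) =
        aeval fun k => powerSub K k (-markedSum K [x] * X K) := by
      refine MvPolynomial.algHom_ext fun k => ?_
      have h2 : markedSum K [x] = z K 1 1 := by simp [markedSum, x]
      have h3 : powerSub K k (z K 1 1 * X K) =
          AddMonoidAlgebra.single (Finsupp.single 1 (k : ℤ)) (p K k) := by
        rw [map_mul, powerSub_z, powerSub_X, mul_one, hzX]
      have h4 : powerSub K k (-z K 1 1 * X K) =
          AddMonoidAlgebra.single (Finsupp.single 1 (k : ℤ)) (-p K k) := by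
        have h5 : -z K 1 1 * X K = -(z K 1 1 * X K) := by ring
        rw [h5, map_neg, h3, AddMonoidAlgebra.single_neg]
      rw [AlgHom.comp_apply, MvPolynomial.aeval_X, MvPolynomial.aeval_X, h2, h3, h4,
        signedOmega_single, Finsupp.degree_single, hneg, omega_p, hk, neg_mul, ← mul_assoc, hsq,
        one_mul]
    exact DFunLike.congr_fun this (h K m)
  have h2 : signedOmega K (pleth (omega K P) (X K - z K 1 (-1))) = pleth P (alphabet K [x]) := by
    have : ((signedOmega K).comp (aeval fun k => powerSub K k (X K - z K 1 (-1)))).comp (omega K) =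
        aeval fun k => powerSub K k (alphabet K [x]) := by
      refine MvPolynomial.algHom_ext fun k => ?_
      have h3 : alphabet K [x] = X K + z K 1 (-1) := by simp [alphabet, x]
      have h4 : omega K (MvPolynomial.X k) = (-1) ^ ((k : ℕ) - 1) * MvPolynomial.X k :=
        omega_p k
      have h6 : signedOmega K (powerSub K k (X K - z K 1 (-1))) =
          AddMonoidAlgebra.single 0 ((-1) ^ ((k : ℕ) - 1) * p K k) -
            AddMonoidAlgebra.single (Finsupp.single 1 (-(k : ℤ))) ((-1) ^ (k : ℕ)) := by
        rw [map_sub, powerSub_z, powerSub_X, map_sub, signedOmega_single, z, signedOmega_single,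
          omega_p, map_one, mul_neg_one, Finsupp.degree_single, hneg', hneg, map_zero,
          Int.negOnePow_zero]
        simp
      have h7 : powerSub K k (X K + z K 1 (-1)) =
          AddMonoidAlgebra.single 0 (p K k) +
            AddMonoidAlgebra.single (Finsupp.single 1 (-(k : ℤ))) 1 := by
        rw [map_add, powerSub_z, powerSub_X, mul_neg_one, z]
      rw [AlgHom.comp_apply, AlgHom.comp_apply, h4, map_mul, MvPolynomial.aeval_X,
        MvPolynomial.aeval_X, h3, map_mul, h6, h7]
      simp only [map_pow, map_neg, map_one]
      have h5 : ((-1 : LaurentLam K) ^ ((k : ℕ) - 1)) =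
          AddMonoidAlgebra.single 0 ((-1 : Lam K) ^ ((k : ℕ) - 1)) := by
        have := AddMonoidAlgebra.single_pow (0 : ℕ →₀ ℤ) (-1 : Lam K) ((k : ℕ) - 1)
        rw [smul_zero] at this
        rw [← this, AddMonoidAlgebra.single_neg]
        rfl
      rw [h5, mul_sub, AddMonoidAlgebra.single_mul_single, AddMonoidAlgebra.single_mul_single,
        zero_add, zero_add, ← mul_assoc, hsq, one_mul, hk, mul_neg, hsq,
        AddMonoidAlgebra.single_neg, sub_neg_eq_add]
    exact DFunLike.congr_fun this P
  have h3 : ZHomogeneous (z K 1 1 * X K) 1 := (zHomogeneous_z 1 1).mul zHomogeneous_X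
  rw [Stilde, S, omega_coeffOmega h3 _ h1, h2, Finsupp.degree_single, hneg]
  have h4 := coeffOmega_eq_extractList (K := K) [x] (by simp) (pleth P (alphabet K [x]))
  have h5 := foldr_slotOp (K := K) [x] (by simp) P
  have h6 : markedPairs K [x] = 1 := by simp [markedPairs]
  rw [h6, one_mul] at h5
  rw [← h5, coeff_single_zero_zero] at h4
  simp only [List.map_cons, List.map_nil, List.sum_cons, List.sum_nil, add_zero, x] at h4
  rw [h4]
  rfl

/-- Without Ω the extraction at z^(-n) reads off the coefficient of u^n in Q[X+u]; for n < 0 there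
is none. -/
theorem perp_hInt_eq_slotOp (v : ℕ) (n : ℤ) (Q : Lam K) :
    perp (hInt K n) Q = slotOp ⟨v, false, -n⟩ Q := by
  rw [slotOp, Polynomial.sum, hInt]
  have h1 : ∀ j : ℕ, omegaCoeff K false (-n + j) = if (j : ℤ) = n then 1 else 0 := by
    intro j
    unfold omegaCoeff
    by_cases hj : (j : ℤ) = n
    · rw [if_pos hj, if_neg (by omega)]
      simp [hj]
    · rw [if_neg hj]
      simp only [Bool.false_eq_true, if_false]
      split_ifs <;> first | rfl | omega
  split_ifs with hn
  · lift n to ℕ using hn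
    simp only [h1, Int.toNat_natCast, Nat.cast_inj, ite_mul, one_mul, zero_mul]
    rw [Finset.sum_ite_eq', ← translate_coeff_eq_perp]
    split_ifs with h2
    · rfl
    · exact Polynomial.notMem_support_iff.1 h2
  · rw [Finset.sum_eq_zero]
    · exact (perpLeft Q).map_zero
    · intro j _
      simp only [h1]
      rw [if_neg (by omega), zero_mul]

end Operators

/-! ### The Jacobi–Trudi determinant and the Vandermonde product -/

section JacobiTrudi

variable {K : Type*} [Field K]

/-- The product of the factors `1 - z_j/z_i` for `i` before `j` in the list. -/
def allPairs (K : Type*) [Field K] : List Slot → LaurentLam K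
  | [] => 1
  | x :: l => (l.map fun y => 1 - z K y.var 1 * z K x.var (-1)).prod * allPairs K l

theorem allPairs_ofFn {n : ℕ} (x : Fin n → Slot) :
    allPairs K (List.ofFn x) =
      ∏ i, ∏ j ∈ Finset.Ioi i, (1 - z K (x j).var 1 * z K (x i).var (-1)) := by
  induction n with
  | zero => simp [allPairs]
  | succ n ih =>
    rw [List.ofFn_succ, allPairs, ih, Fin.prod_univ_succ, Fin.prod_Ioi_zero, List.map_ofFn,
      List.prod_ofFn]
    simp only [Fin.prod_Ioi_succ, Function.comp_def]

theorem z_pow (i : ℕ) (e : ℤ) (k : ℕ) : z K i e ^ k = z K i (k * e) := by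
  rw [z, AddMonoidAlgebra.single_pow, one_pow, z, Finsupp.smul_single]
  simp

/-- Up to a factor z_i^i in each row this is the Vandermonde matrix of the 1/z_i. Giving one z_j to
each pair i < j turns 1/z_j - 1/z_i into 1 - z_j/z_i. -/
theorem det_z_eq_allPairs {n : ℕ} (x : Fin n → Slot) :
    Matrix.det (Matrix.of fun i j : Fin n => z K (x i).var ((i : ℤ) - j)) =
      allPairs K (List.ofFn x) := by
  have h1 : (Matrix.of fun i j : Fin n => z K (x i).var ((i : ℤ) - j)) =
      Matrix.of fun i j : Fin n => z K (x i).var 1 ^ (i : ℕ) *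
        Matrix.vandermonde (fun i => z K (x i).var (-1)) i j := by
    ext1 i j
    rw [Matrix.of_apply, Matrix.of_apply, Matrix.vandermonde_apply, z_pow, z_pow, z_mul_z]
    congr 1
    ring
  have h2 : ∏ j : Fin n, z K (x j).var 1 ^ (j : ℕ) =
      ∏ i : Fin n, ∏ j ∈ Finset.Ioi i, z K (x j).var 1 := by
    rw [Finset.prod_comm' (t' := Finset.univ) (s' := fun j => Finset.Iio j)]
    · refine Finset.prod_congr rfl fun j _ => ?_
      rw [Finset.prod_const, Fin.card_Iio]
    · intro i j
      simp
  rw [h1, Matrix.det_mul_column, Matrix.det_vandermonde, h2, ← Finset.prod_mul_distrib,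
    allPairs_ofFn]
  refine Finset.prod_congr rfl fun i _ => ?_
  rw [← Finset.prod_mul_distrib]
  refine Finset.prod_congr rfl fun j _ => ?_
  rw [mul_sub, z_mul_z]
  simp [z_zero]

/-- When the unmarked slots come first, the only pairs without a factor are those inside the
unmarked block, which the Vandermonde product supplies. -/
theorem markedPairs_append_mul_allPairs (l l' : List Slot) (hl : ∀ y ∈ l, y.mark = false)
    (hl' : ∀ y ∈ l', y.mark = true) :
    allPairs K l * markedPairs K (l ++ l') = allPairs K (l ++ l') := by
  have h1 : ∀ (w : ℕ) (l' : List Slot), (∀ y ∈ l', y.mark = true) →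
      (l'.map (factor K w)) = l'.map fun y => 1 - z K y.var 1 * z K w (-1) := by
    intro w l' hl'
    exact List.map_congr_left fun y hy => if_pos (hl' y hy)
  induction l with
  | nil =>
    rw [allPairs, one_mul, List.nil_append]
    induction l' with
    | nil => rfl
    | cons x l' ih =>
      have hx : ∀ y ∈ l', y.mark = true := fun y hy => hl' y (List.mem_cons_of_mem _ hy)
      rw [allPairs, markedPairs, h1 _ _ hx, ih hx]
  | cons x l ih =>
    have h2 : (l.map (factor K x.var)).prod = 1 := by
      refine List.prod_eq_one fun a ha => ?_
      obtain ⟨y, hy, rfl⟩ := List.mem_map.1 ha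
      refine if_neg ?_
      rw [hl y (List.mem_cons_of_mem _ hy)]
      simp
    rw [List.cons_append, allPairs, allPairs, markedPairs, List.map_append, List.prod_append, h2,
      ← ih fun y hy => hl y (List.mem_cons_of_mem _ hy), List.map_append, List.prod_append,
      h1 _ _ hl']
    ring

/-- A row of length zero adds a last row (0, …, 0, 1). Empty rows are needed because λ^rc may have
fewer than ℓ(λ) - 1 rows, while the ribbon always has ℓ(λ) - 1 unmarked positions. -/
theorem schur_eq_det (μ : YoungDiagram) (n : ℕ) (hn : μ.colLen 0 ≤ n) :
    schur K μ = Matrix.det (Matrix.of fun i j : Fin n =>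
      hInt K ((μ.rowLen i : ℤ) - (i : ℤ) + (j : ℤ))) := by
  induction n, hn using Nat.le_induction with
  | base => rfl
  | succ n hn ih =>
    have h0 : μ.rowLen n = 0 := by
      by_contra h0
      have h1 : (n, 0) ∈ μ := YoungDiagram.mem_iff_lt_rowLen.2 (Nat.pos_of_ne_zero h0)
      have := YoungDiagram.mem_iff_lt_colLen.1 h1
      omega
    rw [ih, Matrix.det_succ_row _ (Fin.last n), Fin.sum_univ_castSucc, Finset.sum_eq_zero,
      zero_add]
    · have h2 : hInt K ((μ.rowLen n : ℤ) - n + n) = 1 := by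
        rw [h0]; simp [hInt, h]
      simp only [Matrix.of_apply, Fin.val_last, h2, ← two_mul, pow_mul, neg_one_sq, one_pow,
        one_mul]
      congr 1
      ext1 i j
      simp
    · intro j _
      have h2 : hInt K ((μ.rowLen n : ℤ) - n + (j : ℕ)) = 0 := by
        rw [h0, hInt, if_neg]
        have := j.2
        omega
      simp only [Matrix.of_apply, Fin.val_last, Fin.val_castSucc, h2]
      simp

theorem extractList_map_sub {ι : Type*} (L : List ι) (x : ι → Slot) (s : ι → ℤ)
    (hL : (L.map fun i => (x i).var).Nodup) (F : LaurentLam K) :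
    extractList (L.map fun i => ⟨(x i).var, (x i).mark, (x i).exp - s i⟩) F =
      extractList (L.map x) ((L.map fun i => z K (x i).var (s i)).prod * F) := by
  induction L with
  | nil => simp
  | cons i L ih =>
    simp only [List.map_cons, List.nodup_cons] at hL
    simp only [List.map_cons, List.prod_cons, extractList_cons]
    rw [ih hL.2, ← extract_z_mul, mul_assoc,
      extractList_mul_of_mem (L.map x) (G := z K (x i).var (s i))]
    intro y hy
    obtain ⟨j, hj, rfl⟩ := List.mem_map.1 hy
    exact z_mem_constSubring
      (fun h0 => hL.1 (List.mem_map.2 ⟨j, hj, h0.symm⟩)) _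

theorem alphabet_congr {l l' : List Slot} (hl : l.map Slot.var = l'.map Slot.var) :
    alphabet K l = alphabet K l' := by
  have h1 : ∀ l : List Slot, (l.map fun y => z K y.var (-1)) =
      (l.map Slot.var).map fun v => z K v (-1) := fun l => by rw [List.map_map]; rfl
  rw [alphabet, alphabet, h1, h1, hl]

theorem markedPairs_map_append {ι : Type*} (L : List ι) (x y : ι → Slot) (l' : List Slot)
    (hv : ∀ i, (x i).var = (y i).var) (hm : ∀ i, (x i).mark = (y i).mark) :
    markedPairs K (L.map x ++ l') = markedPairs K (L.map y ++ l') := by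
  have hf : ∀ v i, factor K v (x i) = factor K v (y i) := by
    intro v i
    rw [factor, factor, hv, hm]
  induction L with
  | nil => rfl
  | cons i L ih =>
    simp only [List.map_cons, List.cons_append, markedPairs, List.map_append, List.map_map, ih,
      Function.comp_def, hf, hv]

variable [CharZero K]

theorem perp_list_prod {ι : Type*} (L : List ι) (f : ι → Lam K) (Q : Lam K) :
    perp ((L.map f).prod) Q = (L.map f).foldr perp Q := by
  induction L with
  | nil => exact perp_one Q
  | cons i L ih => rw [List.map_cons, List.prod_cons, perp_mul, ih, List.foldr_cons]

/-- Each term of the determinant is a composite of unmarked slot operators in the same variables.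
Only the exponents depend on σ, so the sum over σ becomes a sum of monomials inside one common
extraction. -/
theorem single_zero_perp_det (n : ℕ) (x : Fin n → Slot) (hx : ∀ i, (x i).mark = false)
    (l : List Slot) (hl : ∀ y ∈ l, y.mark = true)
    (hnd : ((List.ofFn x ++ l).map Slot.var).Nodup) (P : Lam K) :
    AddMonoidAlgebra.single 0 (perp (Matrix.det (Matrix.of fun i j : Fin n =>
      hInt K (-(x i).exp + i - j))) (l.foldr slotOp P)) =
    extractList (List.ofFn x ++ l)
      (allPairs K (List.ofFn x ++ l) * pleth P (alphabet K (List.ofFn x ++ l))) := by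
  classical
  set A := markedPairs K (List.ofFn x ++ l) * pleth P (alphabet K (List.ofFn x ++ l)) with hA
  have hofFn : List.ofFn x = (List.finRange n).map x := List.ofFn_eq_map
  have hnd1 : ((List.finRange n).map fun i => (x i).var).Nodup := by
    have := (List.nodup_append.1 (by rwa [List.map_append] at hnd)).1
    rwa [hofFn, List.map_map] at this
  have hdisj : ∀ i, ∀ y ∈ l, (x i).var ≠ y.var := by
    intro i y hy
    have := (List.nodup_append.1 (by rwa [List.map_append] at hnd)).2.2
    exact this _ (List.mem_map_of_mem (List.mem_ofFn.2 ⟨i, rfl⟩)) _ (List.mem_map_of_mem hy)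
  have key : ∀ σ : Equiv.Perm (Fin n),
      AddMonoidAlgebra.single 0 (perp (∏ i, hInt K (-(x i).exp + i - σ i)) (l.foldr slotOp P)) =
      extractList (List.ofFn x ++ l) ((∏ i, z K (x i).var ((i : ℤ) - σ i)) * A) := by
    intro σ
    -- Lowering an exponent by i - σ(i) is the same as multiplying by z_i^{i-σ(i)} before
    -- extracting.
    let y : Fin n → Slot := fun i => ⟨(x i).var, (x i).mark, (x i).exp - ((i : ℤ) - σ i)⟩
    have h1 : perp (∏ i, hInt K (-(x i).exp + i - σ i)) (l.foldr slotOp P) =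
        ((List.finRange n).map y ++ l).foldr slotOp P := by
      rw [← List.prod_ofFn, List.ofFn_eq_map, perp_list_prod, List.foldr_append, List.foldr_map,
        List.foldr_map]
      congr 1
      funext i Q
      rw [perp_hInt_eq_slotOp (x i).var]
      simp only [y, hx]
      congr 2
      ring
    have h2 : ((List.finRange n).map y ++ l).map Slot.var = (List.ofFn x ++ l).map Slot.var := by
      rw [hofFn, List.map_append, List.map_append, List.map_map, List.map_map]
      rfl
    rw [h1, foldr_slotOp _ (h2 ▸ hnd), alphabet_congr h2,
      markedPairs_map_append _ y x l (fun _ => rfl) (fun _ => rfl), ← hofFn, ← hA,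
      extractList_append, extractList_append, extractList_map_sub _ x _ hnd1, ← hofFn,
      ← extractList_mul_of_mem l, ← List.ofFn_eq_map, List.prod_ofFn]
    intro w hw
    refine list_prod_mem fun a ha => ?_
    obtain ⟨i, -, rfl⟩ := List.mem_map.1 ha
    exact z_mem_constSubring (hdisj i w hw) _
  have hdet1 : Matrix.det (Matrix.of fun i j : Fin n => hInt K (-(x i).exp + i - j)) =
      ∑ σ : Equiv.Perm (Fin n),
        Equiv.Perm.sign σ • ∏ i, hInt K (-(x i).exp + i - σ i) := by
    rw [← Matrix.det_transpose, Matrix.det_apply]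
    rfl
  have hdet2 : allPairs K (List.ofFn x) =
      ∑ σ : Equiv.Perm (Fin n),
        Equiv.Perm.sign σ • ∏ i, z K (x i).var ((i : ℤ) - σ i) := by
    rw [← det_z_eq_allPairs, ← Matrix.det_transpose, Matrix.det_apply]
    rfl
  have hmark : ∀ y ∈ List.ofFn x, y.mark = false := by
    intro y hy
    obtain ⟨i, rfl⟩ := List.mem_ofFn.1 hy
    exact hx i
  rw [← markedPairs_append_mul_allPairs _ _ hmark hl, mul_assoc, ← hA, hdet1, hdet2,
    Finset.sum_mul, ← extractListHom_apply, map_sum]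
  let ψ : Lam K →+ LaurentLam K := (AddMonoidAlgebra.singleAddHom 0 : Lam K →+ LaurentLam K).comp
    (perpLeft (l.foldr slotOp P)).toAddMonoidHom
  refine (map_sum ψ _ _).trans (Finset.sum_congr rfl fun σ _ => ?_)
  have h3 : ∀ (u : ℤˣ) (f : Lam K), ψ (u • f) = u • ψ f := fun u f => by
    rw [Units.smul_def, map_zsmul, Units.smul_def]
  have h4 : ∀ (u : ℤˣ) (f : LaurentLam K),
      extractListHom K (List.ofFn x ++ l) (u • f) = u • extractListHom K (List.ofFn x ++ l) f :=
    fun u f => by rw [Units.smul_def, map_zsmul, Units.smul_def]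
  rw [h3, smul_mul_assoc, h4, extractListHom_apply, ← key σ]
  rfl

end JacobiTrudi

/-! ### Reordering the variables -/

section Reorder

variable {K : Type*} [Field K]

/-- The product of the differences `z_i - z_j` for `i` before `j` in the list. -/
def differences (K : Type*) [Field K] : List Slot → LaurentLam K
  | [] => 1
  | x :: l => (l.map fun y => z K x.var 1 - z K y.var 1).prod * differences K l

/-- Add to the exponent of each slot the number of slots after it. -/
def staircase : List Slot → List Slot
  | [] => []
  | x :: l => ⟨x.var, x.mark, x.exp + l.length⟩ :: staircase l

theorem map_var_staircase (l : List Slot) : (staircase l).map Slot.var = l.map Slot.var := by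
  induction l with
  | nil => rfl
  | cons x l ih => rw [staircase, List.map_cons, List.map_cons, ih]

theorem differences_congr {l l' : List Slot} (hl : l.map Slot.var = l'.map Slot.var) :
    differences K l = differences K l' := by
  induction l generalizing l' with
  | nil =>
    cases l' with
    | nil => rfl
    | cons y l' => simp at hl
  | cons x l ih =>
    cases l' with
    | nil => simp at hl
    | cons y l' =>
      rw [List.map_cons, List.map_cons, List.cons.injEq] at hl
      have h1 : ∀ (w : ℕ) (l : List Slot), (l.map fun y => z K w 1 - z K y.var 1) =
          (l.map Slot.var).map fun v => z K w 1 - z K v 1 :=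
        fun w l => by rw [List.map_map]; rfl
      rw [differences, differences, ih hl.2, h1, h1, hl.1, hl.2]

/-- A slot followed by N others has N factors 1 - z_j/z_i; multiplying by z_i^N clears their
denominators and raises the exponent by N. The new product is antisymmetric, so slots can be
permuted up to sign, each keeping its exponent. -/
theorem extractList_allPairs_mul (l : List Slot) (hl : (l.map Slot.var).Nodup)
    (F : LaurentLam K) :
    extractList l (allPairs K l * F) =
      extractList (staircase l) (differences K (staircase l) * F) := by
  rw [differences_congr (map_var_staircase l)]
  induction l generalizing F with
  | nil => rfl
  | cons x l ih =>
    have h1 : (l.map fun y => z K x.var 1 - z K y.var 1).prod =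
        z K x.var l.length * (l.map fun y => 1 - z K y.var 1 * z K x.var (-1)).prod := by
      clear ih hl
      induction l with
      | nil => simp [z_zero]
      | cons y l ih =>
        rw [List.map_cons, List.prod_cons, ih, List.map_cons, List.prod_cons, List.length_cons]
        push_cast
        rw [← z_mul_z]
        have h2 : z K x.var 1 * z K x.var (-1) = 1 := by rw [z_mul_z]; simp [z_zero]
        linear_combination
          (z K y.var 1 * z K x.var l.length *
            (l.map fun y => 1 - z K y.var 1 * z K x.var (-1)).prod) * h2
    have hx : x.var ∉ l.map Slot.var := (List.nodup_cons.1 hl).1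
    rw [allPairs, differences, h1, staircase, extractList_cons, extractList_cons]
    have h3 : (l.map fun y => 1 - z K y.var 1 * z K x.var (-1)).prod * allPairs K l * F =
        allPairs K l * ((l.map fun y => 1 - z K y.var 1 * z K x.var (-1)).prod * F) := by ring
    have h4 : z K x.var l.length * (l.map fun y => 1 - z K y.var 1 * z K x.var (-1)).prod *
        differences K l * F = z K x.var l.length * (differences K l *
          ((l.map fun y => 1 - z K y.var 1 * z K x.var (-1)).prod * F)) := by ring
    rw [h3, h4, extractList_mul_of_mem (staircase l) (G := z K x.var l.length), extract_z_mul,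
      ih (List.nodup_cons.1 hl).2]
    · congr 2
      simp
    · intro y hy
      have : y.var ∈ l.map Slot.var := map_var_staircase l ▸ List.mem_map_of_mem hy
      exact z_mem_constSubring (v := y.var) (i := x.var) (fun h0 => hx (h0 ▸ this)) _

theorem extract_comm {x y : Slot} (hxy : x.var ≠ y.var) (F : LaurentLam K) :
    extract x (extract y F) = extract y (extract x F) := by
  induction F using AddMonoidAlgebra.induction_linear with
  | zero => simp
  | add F G hF hG => simp only [map_add, hF, hG]
  | single b f =>
    simp only [extract_single]
    rw [Finsupp.erase_ne hxy, Finsupp.erase_ne hxy.symm, mul_left_comm]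
    congr 1
    ext i
    simp only [Finsupp.erase_apply]
    split_ifs <;> rfl

theorem differences_swap (l₁ : List Slot) (x y : Slot) (l₂ : List Slot) :
    differences K (l₁ ++ x :: y :: l₂) = -differences K (l₁ ++ y :: x :: l₂) := by
  induction l₁ with
  | nil =>
    simp only [List.nil_append, differences, List.map_cons, List.prod_cons]
    ring
  | cons w l₁ ih =>
    have h1 : ((l₁ ++ x :: y :: l₂).map fun y => z K w.var 1 - z K y.var 1).prod =
        ((l₁ ++ y :: x :: l₂).map fun y => z K w.var 1 - z K y.var 1).prod :=
      List.Perm.prod_eq (((List.Perm.swap y x l₂).append_left l₁).map _)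
    rw [List.cons_append, List.cons_append, differences, differences, ih, h1]
    ring

theorem extractList_differences_swap (l₁ : List Slot) {x y : Slot} (hxy : x.var ≠ y.var)
    (l₂ : List Slot) (F : LaurentLam K) :
    extractList (l₁ ++ x :: y :: l₂) (differences K (l₁ ++ x :: y :: l₂) * F) =
      -extractList (l₁ ++ y :: x :: l₂) (differences K (l₁ ++ y :: x :: l₂) * F) := by
  have h1 : ∀ G : LaurentLam K,
      extractList (l₁ ++ x :: y :: l₂) G = extractList (l₁ ++ y :: x :: l₂) G := by
    intro G
    rw [extractList_append, extractList_append]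
    simp only [extractList_cons]
    rw [extract_comm hxy]
  have h2 : -differences K (l₁ ++ y :: x :: l₂) * F =
      -(differences K (l₁ ++ y :: x :: l₂) * F) := by ring
  rw [h1, differences_swap, h2, ← extractListHom_apply, ← extractListHom_apply, map_neg]

theorem extractList_differences_move (l₁ : List Slot) (x : Slot) (l l₂ : List Slot)
    (hx : ∀ y ∈ l, x.var ≠ y.var) (F : LaurentLam K) :
    extractList (l₁ ++ x :: (l ++ l₂)) (differences K (l₁ ++ x :: (l ++ l₂)) * F) =
      (-1) ^ l.length *
        extractList (l₁ ++ (l ++ x :: l₂)) (differences K (l₁ ++ (l ++ x :: l₂)) * F) := by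
  induction l generalizing l₁ with
  | nil => simp
  | cons y l ih =>
    have h1 := ih (l₁ ++ [y]) fun w hw => hx w (List.mem_cons_of_mem _ hw)
    simp only [List.append_assoc, List.cons_append, List.nil_append] at h1
    rw [List.cons_append, extractList_differences_swap _ (hx y List.mem_cons_self), h1,
      List.length_cons, pow_succ, List.cons_append]
    ring

/-- The number of pairs `i` before `j` such that `i` is marked and `j` is not. -/
def inversions : List Slot → ℕ
  | [] => 0
  | x :: l => (if x.mark then (l.filter fun y => !y.mark).length else 0) + inversions l

/-- Once the tail is sorted, a marked head only has to pass its unmarked slots, one sign each. The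
prefix `l₁` is present so that the induction hypothesis applies behind the head. -/
theorem extractList_differences_partition (l₁ l : List Slot)
    (hl : (l.map Slot.var).Nodup) (F : LaurentLam K) :
    extractList (l₁ ++ l) (differences K (l₁ ++ l) * F) =
      (-1) ^ inversions l *
        extractList (l₁ ++ ((l.filter fun y => !y.mark) ++ l.filter fun y => y.mark))
          (differences K (l₁ ++ ((l.filter fun y => !y.mark) ++ l.filter fun y => y.mark)) * F)
      := by
  induction l generalizing l₁ with
  | nil => simp [inversions]
  | cons x l ih =>
    have h1 := ih (l₁ ++ [x]) (List.nodup_cons.1 hl).2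
    simp only [List.append_assoc, List.cons_append, List.nil_append] at h1
    rw [h1]
    rcases hx : x.mark with _ | _
    · simp [inversions, hx]
    · have hx' : ∀ y ∈ l.filter (fun y => !y.mark), x.var ≠ y.var := fun y hy h0 =>
        (List.nodup_cons.1 hl).1 (h0 ▸ List.mem_map_of_mem (List.mem_of_mem_filter hy))
      rw [extractList_differences_move _ _ _ _ hx']
      simp [inversions, hx, pow_add, mul_left_comm, mul_assoc]

end Reorder

/-! ### Combinatorics of the ribbon -/

section Combinatorics

variable (lam : YoungDiagram)

theorem mem_iff_lt_colLen_iff_lt_rowLen (i j : ℕ) :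
    i < lam.colLen j ↔ j < lam.rowLen i := by
  rw [← YoungDiagram.mem_iff_lt_colLen, YoungDiagram.mem_iff_lt_rowLen]

theorem mem_ribbon (c : ℕ × ℕ) :
    c ∈ ribbon lam ↔ c ∈ lam ∧ (c.1 + 1, c.2 + 1) ∉ lam := by
  simp only [ribbon, rc, Finset.mem_sdiff, Finset.mem_filter, YoungDiagram.mem_cells]
  tauto

theorem mem_rc (c : ℕ × ℕ) : c ∈ rc lam ↔ (c.1 + 1, c.2 + 1) ∈ lam := by
  change c ∈ lam.cells.filter (fun c => (c.1 + 1, c.2 + 1) ∈ lam.cells) ↔ _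
  rw [Finset.mem_filter, YoungDiagram.mem_cells, YoungDiagram.mem_cells]
  exact ⟨fun hc => hc.2, fun hc =>
    ⟨lam.up_left_mem (Nat.le_succ c.1) (Nat.le_succ c.2) hc, hc⟩⟩

theorem rowLen_rc (i : ℕ) : (rc lam).rowLen i = lam.rowLen (i + 1) - 1 := by
  refine eq_of_forall_lt_iff fun j => ?_
  rw [← YoungDiagram.mem_iff_lt_rowLen, mem_rc, YoungDiagram.mem_iff_lt_rowLen]
  change j + 1 < lam.rowLen (i + 1) ↔ _
  omega

theorem colLen_rc_le : (rc lam).colLen 0 ≤ lam.colLen 0 - 1 := by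
  refine le_of_forall_lt fun i hi => ?_
  rw [← YoungDiagram.mem_iff_lt_colLen, mem_rc] at hi
  have := YoungDiagram.mem_iff_lt_colLen.1 (lam.up_left_mem le_rfl (Nat.zero_le _) hi)
  omega

theorem colLen_zero_pos (hlam : lam ≠ ⊥) : 0 < lam.colLen 0 := by
  by_contra h0
  refine hlam (YoungDiagram.ext (Finset.eq_empty_of_forall_notMem fun c hc => h0 ?_))
  have := YoungDiagram.mem_iff_lt_colLen.1
    (lam.up_left_mem (Nat.zero_le c.1) (Nat.zero_le c.2) hc)
  exact this

theorem rowLen_zero_pos (hlam : lam ≠ ⊥) : 0 < lam.rowLen 0 :=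
  (mem_iff_lt_colLen_iff_lt_rowLen lam 0 0).1 (colLen_zero_pos lam hlam)

theorem fst_lt_of_mem {c : ℕ × ℕ} (hc : c ∈ lam) : c.1 < lam.colLen 0 :=
  YoungDiagram.mem_iff_lt_colLen.1 (lam.up_left_mem le_rfl (Nat.zero_le c.2) hc)

theorem snd_lt_of_mem {c : ℕ × ℕ} (hc : c ∈ lam) : c.2 < lam.rowLen 0 :=
  YoungDiagram.mem_iff_lt_rowLen.1 (lam.up_left_mem (Nat.zero_le c.1) le_rfl hc)

/-- The content of a cell, shifted so that the first cell of the ribbon has content `1`. -/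
def content (c : ℕ × ℕ) : ℕ := c.2 + lam.colLen 0 - c.1

/-- No ribbon cell lies strictly above and strictly to the right of another: the diagonal successor
of the latter would then be in λ. Hence content orders the ribbon just as the labelling does. -/
theorem content_le_iff {c d : ℕ × ℕ} (hc : c ∈ ribbon lam) (hd : d ∈ ribbon lam) :
    content lam d ≤ content lam c ↔ d.2 ≤ c.2 ∧ c.1 ≤ d.1 := by
  rw [mem_ribbon] at hc hd
  have h1 := fst_lt_of_mem lam hc.1
  have h2 := fst_lt_of_mem lam hd.1
  unfold content
  refine ⟨fun h3 => ?_, fun h3 => by omega⟩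
  constructor
  · by_contra h4
    exact hc.2 (lam.up_left_mem (i2 := d.1) (j2 := d.2) (by omega) (by omega) hd.1)
  · by_contra h4
    exact hd.2 (lam.up_left_mem (i2 := c.1) (j2 := c.2) (by omega) (by omega) hc.1)

theorem content_injOn : Set.InjOn (content lam) (ribbon lam) := by
  intro c hc d hd hcd
  have h1 := (content_le_iff lam hc hd).1 hcd.ge
  have h2 := (content_le_iff lam hd hc).1 hcd.le
  exact Prod.ext (le_antisymm h1.2 h2.2) (le_antisymm h2.1 h1.1)

theorem exists_mem_ribbon_add {c : ℕ × ℕ} (hc : c ∈ lam) :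
    ∃ n, (c.1 + n, c.2 + n) ∈ ribbon lam := by
  by_contra! h0
  have h1 : ∀ n, (c.1 + n, c.2 + n) ∈ lam := by
    intro n
    induction n with
    | zero => exact hc
    | succ n ih =>
      by_contra h2
      exact h0 n ((mem_ribbon _ _).2 ⟨ih, h2⟩)
  have := fst_lt_of_mem lam (h1 (lam.colLen 0))
  simp only at this
  omega

/-- Each diagonal meeting λ leaves it through a ribbon cell; the starting cells in the bottom row
and the first column cover all contents. -/
theorem image_content_ribbon :
    (ribbon lam).image (content lam) = Finset.Icc 1 (lam.colLen 0 + lam.rowLen 0 - 1) := by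
  ext k
  rw [Finset.mem_image, Finset.mem_Icc]
  constructor
  · rintro ⟨c, hc, rfl⟩
    have hc := ((mem_ribbon _ _).1 hc).1
    have h1 := fst_lt_of_mem lam hc
    have h2 := snd_lt_of_mem lam hc
    unfold content
    omega
  · rintro ⟨h1, h2⟩
    rcases le_or_gt (lam.colLen 0) k with h3 | h3
    · have h4 : (0, k - lam.colLen 0) ∈ lam := YoungDiagram.mem_iff_lt_rowLen.2 (by omega)
      obtain ⟨n, hn⟩ := exists_mem_ribbon_add lam h4
      refine ⟨_, hn, ?_⟩
      simp only [content]
      omega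
    · have h4 : (lam.colLen 0 - k, 0) ∈ lam := YoungDiagram.mem_iff_lt_colLen.2 (by omega)
      obtain ⟨n, hn⟩ := exists_mem_ribbon_add lam h4
      refine ⟨_, hn, ?_⟩
      simp only [content]
      omega

theorem card_ribbon : (ribbon lam).card = lam.colLen 0 + lam.rowLen 0 - 1 := by
  rw [← Finset.card_image_of_injOn (content_injOn lam), image_content_ribbon, Nat.card_Icc]
  omega

theorem label_eq_content {c : ℕ × ℕ} (hc : c ∈ ribbon lam) : label lam c = content lam c := by
  have h1 : ((ribbon lam).filter fun d => d.2 ≤ c.2 ∧ c.1 ≤ d.1) =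
      (ribbon lam).filter fun d => content lam d ≤ content lam c :=
    Finset.filter_congr fun d hd => (content_le_iff lam hc hd).symm
  have h2 : ((ribbon lam).filter fun d => content lam d ≤ content lam c).image (content lam) =
      Finset.Icc 1 (content lam c) := by
    have h3 : content lam c ∈ Finset.Icc 1 (lam.colLen 0 + lam.rowLen 0 - 1) :=
      image_content_ribbon lam ▸ Finset.mem_image_of_mem _ hc
    rw [Finset.mem_Icc] at h3
    rw [← Finset.filter_image (p := fun k => k ≤ content lam c), image_content_ribbon]
    ext k
    simp only [Finset.mem_filter, Finset.mem_Icc]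
    omega
  rw [label, h1, ← Finset.card_image_of_injOn ((content_injOn lam).mono (Finset.filter_subset _ _)),
    h2, Nat.card_Icc]
  omega

/-- Descents sit at the right ends of the rows r ≥ 1: the last cell of row r has a ribbon cell
directly below it, and the equation gives its content. -/
theorem mem_descents (i : ℕ) : i ∈ descents lam ↔
    ∃ r, 1 ≤ r ∧ r < lam.colLen 0 ∧ i + 1 + r = lam.colLen 0 + lam.rowLen r := by
  unfold descents
  rw [Finset.mem_filter, Finset.mem_Icc, card_ribbon]
  constructor
  · rintro ⟨-, c, hc, d, hd, h1, h2, h3⟩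
    rw [label_eq_content lam hc, content] at h1
    rw [label_eq_content lam hd, content] at h2
    rw [mem_ribbon] at hc hd
    have hc1 := fst_lt_of_mem lam hc.1
    have hd1 := fst_lt_of_mem lam hd.1
    refine ⟨c.1, by omega, hc1, ?_⟩
    have h4 := YoungDiagram.mem_iff_lt_rowLen.1 (show (c.1, c.2) ∈ lam from hc.1)
    have h5 : ¬ c.2 + 1 < lam.rowLen c.1 := by
      intro h5
      exact hd.2 (lam.up_left_mem (by omega) (by omega) (YoungDiagram.mem_iff_lt_rowLen.2 h5))
    omega
  · rintro ⟨r, h1, h2, h3⟩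
    have h4 : 0 < lam.rowLen r := (mem_iff_lt_colLen_iff_lt_rowLen lam r 0).1 h2
    have h5 := lam.rowLen_anti 0 r (Nat.zero_le r)
    have h6 : (r, lam.rowLen r - 1) ∈ lam := YoungDiagram.mem_iff_lt_rowLen.2 (by omega)
    have h7 : ∀ i, (r + i, lam.rowLen r) ∉ lam := by
      intro i hi
      have := YoungDiagram.mem_iff_lt_rowLen.1 (lam.up_left_mem (Nat.le_add_right r i) le_rfl hi)
      omega
    have hc : (r, lam.rowLen r - 1) ∈ ribbon lam := by
      rw [mem_ribbon]
      refine ⟨h6, ?_⟩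
      simp only
      rw [Nat.sub_add_cancel h4]
      exact h7 1
    have hd : (r - 1, lam.rowLen r - 1) ∈ ribbon lam := by
      rw [mem_ribbon]
      refine ⟨lam.up_left_mem (Nat.sub_le r 1) le_rfl h6, ?_⟩
      simp only
      rw [Nat.sub_add_cancel h4, Nat.sub_add_cancel h1]
      exact h7 0
    refine ⟨by omega, _, hc, _, hd, ?_, ?_, ?_⟩
    · rw [label_eq_content lam hc, content]; omega
    · rw [label_eq_content lam hd, content]; simp only; omega
    · simp only; omega

theorem card_descents : (descents lam).card = lam.colLen 0 - 1 := by
  have h1 : descents lam = (Finset.Ico 1 (lam.colLen 0)).image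
      fun r => lam.colLen 0 + lam.rowLen r - r - 1 := by
    ext i
    rw [mem_descents, Finset.mem_image]
    constructor
    · rintro ⟨r, h1, h2, h3⟩
      exact ⟨r, Finset.mem_Ico.2 ⟨h1, h2⟩, by omega⟩
    · rintro ⟨r, hr, rfl⟩
      rw [Finset.mem_Ico] at hr
      have := (mem_iff_lt_colLen_iff_lt_rowLen lam r 0).1 hr.2
      exact ⟨r, hr.1, hr.2, by omega⟩
  rw [h1, Finset.card_image_of_injOn, Nat.card_Ico]
  intro r hr s hs hrs
  simp only [Finset.coe_Ico, Set.mem_Ico] at hr hs hrs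
  rcases lt_trichotomy r s with h2 | h2 | h2
  · have := lam.rowLen_anti r s h2.le
    omega
  · exact h2
  · have := lam.rowLen_anti s r h2.le
    omega

/-- Cell k is the top of its column exactly when it was not reached by a step down. For k = 1 this
holds because 0 is never a descent. -/
theorem exists_col_iff_notMem_descents {k : ℕ} (h1 : 1 ≤ k)
    (h2 : k ≤ lam.colLen 0 + lam.rowLen 0 - 1) :
    k - 1 ∉ descents lam ↔
      ∃ j, j < lam.rowLen 0 ∧ k + lam.colLen j = lam.colLen 0 + j + 1 := by
  rw [mem_descents]
  constructor
  · intro h3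
    have h4 : k ∈ (ribbon lam).image (content lam) := by
      rw [image_content_ribbon, Finset.mem_Icc]; exact ⟨h1, h2⟩
    obtain ⟨c, hc, rfl⟩ := Finset.mem_image.1 h4
    rw [mem_ribbon] at hc
    have h5 := fst_lt_of_mem lam hc.1
    refine ⟨c.2, snd_lt_of_mem lam hc.1, ?_⟩
    have h6 := YoungDiagram.mem_iff_lt_colLen.1 (show (c.1, c.2) ∈ lam from hc.1)
    have h7 : ¬ c.1 + 1 < lam.colLen c.2 := by
      intro h7
      refine h3 ⟨c.1 + 1, by omega, ?_, ?_⟩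
      · exact fst_lt_of_mem lam (YoungDiagram.mem_iff_lt_colLen.2 h7)
      · have h8 := (mem_iff_lt_colLen_iff_lt_rowLen lam _ _).1 h7
        have h9 : ¬ c.2 + 1 < lam.rowLen (c.1 + 1) :=
          fun h9 => hc.2 (YoungDiagram.mem_iff_lt_rowLen.2 h9)
        unfold content at h1 ⊢
        omega
    unfold content
    omega
  -- The two equations give j - λ_r + 1 = λ'_j - r, which contradicts the equivalence r < λ'_j ↔ j <
  -- λ_r in either case.
  · rintro ⟨j, hj, h3⟩ ⟨r, hr1, hr2, h4⟩
    have := mem_iff_lt_colLen_iff_lt_rowLen lam r j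
    omega

/-- Both lists increase strictly and have the same members. Increasing position means going from the
top row downwards, which fixes the order of `rowSlot`. -/
theorem filter_mem_descents :
    (List.range' 1 (lam.colLen 0 + lam.rowLen 0 - 1)).filter
      (fun k => decide (k - 1 ∈ descents lam)) =
    (List.range (lam.colLen 0 - 1)).map fun i => i + 1 + lam.rowLen (lam.colLen 0 - 1 - i) := by
  refine List.Pairwise.eq_of_mem_iff (r := (· < ·))
    (List.Pairwise.filter _ (List.pairwise_lt_range' (step := 1))) ?_ ?_
  · rw [List.pairwise_map]
    refine List.pairwise_lt_range.imp fun {i j} hij => ?_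
    have := lam.rowLen_anti (lam.colLen 0 - 1 - j) (lam.colLen 0 - 1 - i) (by omega)
    omega
  · intro k
    simp only [List.mem_filter, List.mem_range'_1, decide_eq_true_eq, mem_descents, List.mem_map,
      List.mem_range]
    constructor
    · rintro ⟨h1, r, hr1, hr2, h2⟩
      refine ⟨lam.colLen 0 - 1 - r, by omega, ?_⟩
      have h3 : lam.colLen 0 - 1 - (lam.colLen 0 - 1 - r) = r ∨ r = lam.colLen 0 := by omega
      rcases h3 with h3 | h3
      · rw [h3]; omega
      · omega
    · rintro ⟨i, hi, rfl⟩
      have h3 := lam.rowLen_anti 0 (lam.colLen 0 - 1 - i) (Nat.zero_le _)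
      exact ⟨by omega, lam.colLen 0 - 1 - i, by omega, by omega, by omega⟩

theorem filter_notMem_descents :
    (List.range' 1 (lam.colLen 0 + lam.rowLen 0 - 1)).filter
      (fun k => decide (k - 1 ∉ descents lam)) =
    (List.range (lam.rowLen 0)).map fun j => lam.colLen 0 + j + 1 - lam.colLen j := by
  have hcol : ∀ j, lam.colLen j ≤ lam.colLen 0 := fun j => lam.colLen_anti 0 j (Nat.zero_le j)
  refine List.Pairwise.eq_of_mem_iff (r := (· < ·))
    (List.Pairwise.filter _ (List.pairwise_lt_range' (step := 1))) ?_ ?_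
  · rw [List.pairwise_map]
    refine List.pairwise_lt_range.imp fun {i j} hij => ?_
    have := lam.colLen_anti i j hij.le
    have := hcol i
    omega
  · intro k
    simp only [List.mem_filter, List.mem_range'_1, decide_eq_true_eq, List.mem_map,
      List.mem_range]
    constructor
    · rintro ⟨h1, h2⟩
      obtain ⟨j, hj, h3⟩ := (exists_col_iff_notMem_descents lam h1.1 (by omega)).1 h2
      exact ⟨j, hj, by omega⟩
    · rintro ⟨j, hj, rfl⟩
      have h3 := hcol j
      have h4 := (mem_iff_lt_colLen_iff_lt_rowLen lam 0 j).2 hj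
      exact ⟨by omega,
        (exists_col_iff_notMem_descents lam (by omega) (by omega)).2 ⟨j, hj, by omega⟩⟩

end Combinatorics

/-! ### Inversions -/

section Inversions

theorem length_staircase (l : List Slot) : (staircase l).length = l.length := by
  have := congrArg List.length (map_var_staircase l)
  simpa using this

theorem length_filter_not_mark (l : List Slot) :
    (l.filter fun y => !y.mark).length + (l.filter fun y => y.mark).length = l.length := by
  induction l with
  | nil => rfl
  | cons x l ih =>
    rcases hx : x.mark with _ | _ <;> simp [hx] <;> omega

/-- With all exponents 1, the staircase exponent minus 1 counts the later slots. Summed over marked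
slots, the later marked ones give the binomial coefficient and the later unmarked ones the
inversions. -/
theorem inversions_staircase (l : List Slot) (hl : ∀ y ∈ l, y.exp = 1) :
    (inversions (staircase l) : ℤ) + (((staircase l).filter fun y => y.mark).length.choose 2 : ℕ) =
      (((staircase l).filter fun y => y.mark).map fun y => y.exp - 1).sum := by
  induction l with
  | nil => rfl
  | cons x l ih =>
    have h1 := ih fun y hy => hl y (List.mem_cons_of_mem _ hy)
    have h2 := hl x List.mem_cons_self
    have h3 := length_filter_not_mark (staircase l)
    rw [length_staircase] at h3
    rcases hx : x.mark with _ | _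
    · simpa [staircase, inversions, hx] using h1
    · simp only [staircase, inversions, hx, if_true, List.filter_cons_of_pos, List.length_cons,
        List.map_cons, List.sum_cons]
      rw [← h1, Nat.choose_succ_succ' _ 1, Nat.choose_one_right, h2, ← h3]
      push_cast
      ring

theorem sum_range_sub (n : ℕ) :
    ((List.range n).map fun j => ((n - 1 - j : ℕ) : ℤ)).sum = (n.choose 2 : ℕ) := by
  induction n with
  | zero => rfl
  | succ n ih =>
    rw [List.range_succ_eq_map, List.map_cons, List.sum_cons, List.map_map,
      Nat.choose_succ_succ' _ 1, Nat.choose_one_right, Nat.cast_add, ← ih]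
    congr 1
    congr 1
    refine List.map_congr_left fun j _ => ?_
    simp only [Function.comp_def]
    congr 1
    omega

end Inversions

/-! ### The slots of a partition -/

section Slots

/-- The slots of the right-hand side of the ribbon formula: a position is marked if it is the
topmost cell of a column of the ribbon. -/
def positionSlots (lam : YoungDiagram) (m : ℕ) : List Slot :=
  (List.range' 1 m).map fun k => ⟨k, decide (k - 1 ∉ descents lam), 1⟩

/-- The slots of the operators `S̃_{λ'_j}`. -/
def columnSlots (lam : YoungDiagram) : List Slot :=
  (List.range (lam.rowLen 0)).map fun j =>
    ⟨lam.colLen 0 + j + 1 - lam.colLen j, true, lam.colLen j⟩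

/-- The slots of the rows of `λ^rc`, from top to bottom. -/
def rowSlot (lam : YoungDiagram) (i : ℕ) : Slot :=
  ⟨i + 1 + lam.rowLen (lam.colLen 0 - 1 - i), false,
    -((lam.rowLen (lam.colLen 0 - 1 - i) - 1 : ℕ) : ℤ)⟩

/-- The slots of the left-hand side of the ribbon formula. -/
def operatorSlots (lam : YoungDiagram) : List Slot :=
  List.ofFn (fun i : Fin (lam.colLen 0 - 1) => rowSlot lam i) ++ columnSlots lam

theorem staircase_map_range' (f : ℕ → Bool) (s n : ℕ) :
    staircase ((List.range' s n).map fun k => ⟨k, f k, 1⟩) =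
      (List.range' s n).map fun k => ⟨k, f k, (s : ℤ) + n - k⟩ := by
  induction n generalizing s with
  | zero => rfl
  | succ n ih =>
    rw [List.range'_succ, List.map_cons, List.map_cons, staircase, ih]
    simp only [List.length_map, List.length_range']
    congr 1
    · congr 1
      push_cast
      ring
    · refine List.map_congr_left fun k _ => ?_
      congr 1
      push_cast
      ring

theorem staircase_map_range_append (f : ℕ → Slot) (n : ℕ) (l : List Slot) :
    staircase ((List.range n).map f ++ l) = (List.range n).map (fun i =>
      ⟨(f i).var, (f i).mark, (f i).exp + ((n - 1 - i + l.length : ℕ) : ℤ)⟩) ++ staircase l := by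
  induction n generalizing f with
  | zero => rfl
  | succ n ih =>
    rw [List.range_succ_eq_map, List.map_cons, List.map_map, List.cons_append, staircase, ih,
      List.map_cons, List.cons_append, List.map_map]
    congr 1
    · simp
    · congr 1
      refine List.map_congr_left fun i _ => ?_
      simp only [Function.comp_apply]
      have h1 : n + 1 - 1 - (i + 1) = n - 1 - i := by omega
      rw [Nat.succ_eq_add_one, h1]

theorem ofFn_rowSlot (lam : YoungDiagram) (n : ℕ) :
    List.ofFn (fun i : Fin n => rowSlot lam i) = (List.range n).map (rowSlot lam) := by
  rw [List.ofFn_eq_map, ← List.map_coe_finRange_eq_range, List.map_map]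
  rfl

variable (lam : YoungDiagram)

/-- Position k carries the exponent m + 1 - k. At the top cell of column j, k = ℓ + j + 1 - λ'_j,
which makes it λ'_j plus the number of later columns. -/
theorem filter_mark_staircase_positionSlots :
    (staircase (positionSlots lam (lam.colLen 0 + lam.rowLen 0 - 1))).filter (fun y => y.mark) =
      (List.range (lam.rowLen 0)).map fun j => ⟨lam.colLen 0 + j + 1 - lam.colLen j, true,
        lam.colLen j + ((lam.rowLen 0 - 1 - j : ℕ) : ℤ)⟩ := by
  have h1 : (List.range' 1 (lam.colLen 0 + lam.rowLen 0 - 1)).filter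
      ((fun y : Slot => y.mark) ∘ fun k => (⟨k, decide (k - 1 ∉ descents lam),
        ((1 : ℕ) : ℤ) + (lam.colLen 0 + lam.rowLen 0 - 1 : ℕ) - k⟩ : Slot)) =
      (List.range' 1 (lam.colLen 0 + lam.rowLen 0 - 1)).filter
        (fun k => decide (k - 1 ∉ descents lam)) := rfl
  rw [positionSlots, staircase_map_range' (fun k => decide (k - 1 ∉ descents lam)),
    List.filter_map, h1, filter_notMem_descents, List.map_map]
  refine List.map_congr_left fun j hj => ?_
  have hj := List.mem_range.1 hj
  have h2 := lam.colLen_anti 0 j (Nat.zero_le j)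
  have h3 := (mem_iff_lt_colLen_iff_lt_rowLen lam 0 j).2 hj
  have h4 : j ∈ List.range (lam.rowLen 0) := List.mem_range.2 hj
  have h5 : lam.colLen 0 + j + 1 - lam.colLen j - 1 ∉ descents lam := by
    rw [exists_col_iff_notMem_descents lam (by omega) (by omega)]
    exact ⟨j, hj, by omega⟩
  simp only [Function.comp_apply, Slot.mk.injEq, decide_eq_true_eq]
  exact ⟨trivial, h5, by omega⟩

/-- Here k = i + 1 + λ_r with r = ℓ - 1 - i, and m + 1 - k is -(λ_r - 1) plus the number of slots
that follow row r in the operator order. -/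
theorem filter_not_mark_staircase_positionSlots :
    (staircase (positionSlots lam (lam.colLen 0 + lam.rowLen 0 - 1))).filter (fun y => !y.mark) =
      (List.range (lam.colLen 0 - 1)).map fun i => ⟨(rowSlot lam i).var, (rowSlot lam i).mark,
        (rowSlot lam i).exp + ((lam.colLen 0 - 1 - 1 - i + (columnSlots lam).length : ℕ) : ℤ)⟩ := by
  have h1 : (List.range' 1 (lam.colLen 0 + lam.rowLen 0 - 1)).filter
      ((fun y : Slot => !y.mark) ∘ fun k => (⟨k, decide (k - 1 ∉ descents lam),
        ((1 : ℕ) : ℤ) + (lam.colLen 0 + lam.rowLen 0 - 1 : ℕ) - k⟩ : Slot)) =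
      (List.range' 1 (lam.colLen 0 + lam.rowLen 0 - 1)).filter
        (fun k => decide (k - 1 ∈ descents lam)) :=
    List.filter_congr fun k _ => by simp
  rw [positionSlots, staircase_map_range' (fun k => decide (k - 1 ∉ descents lam)),
    List.filter_map, h1, filter_mem_descents, List.map_map]
  refine List.map_congr_left fun i hi => ?_
  have hi := List.mem_range.1 hi
  have h2 := (mem_iff_lt_colLen_iff_lt_rowLen lam (lam.colLen 0 - 1 - i) 0).1 (by omega)
  have h3 := lam.rowLen_anti 0 _ (Nat.zero_le (lam.colLen 0 - 1 - i))
  have h5 : i + 1 + lam.rowLen (lam.colLen 0 - 1 - i) - 1 ∈ descents lam := by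
    rw [mem_descents]
    exact ⟨lam.colLen 0 - 1 - i, by omega, by omega, by omega⟩
  simp only [Function.comp_apply, rowSlot, columnSlots, Slot.mk.injEq, decide_eq_false_iff_not,
    not_not, List.length_map, List.length_range]
  exact ⟨trivial, h5, by omega⟩

/-- The combinatorial core: after the staircase shift, the operator side is the right-hand side with
its unmarked slots moved to the front. -/
theorem staircase_operatorSlots :
    staircase (operatorSlots lam) =
      ((staircase (positionSlots lam (lam.colLen 0 + lam.rowLen 0 - 1))).filter
        fun y => !y.mark) ++
      (staircase (positionSlots lam (lam.colLen 0 + lam.rowLen 0 - 1))).filter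
        fun y => y.mark := by
  rw [operatorSlots, ofFn_rowSlot, staircase_map_range_append,
    filter_not_mark_staircase_positionSlots, filter_mark_staircase_positionSlots]
  congr 1
  have h1 := staircase_map_range_append (fun j => (⟨lam.colLen 0 + j + 1 - lam.colLen j, true,
    lam.colLen j⟩ : Slot)) (lam.rowLen 0) []
  simp only [List.append_nil, List.length_nil, add_zero] at h1
  rw [columnSlots, h1, staircase, List.append_nil]

theorem nodup_positionSlots (m : ℕ) : ((positionSlots lam m).map Slot.var).Nodup := by
  rw [positionSlots, List.map_map]
  have h1 : (Slot.var ∘ fun k => (⟨k, decide (k - 1 ∉ descents lam), 1⟩ : Slot)) = id := rfl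
  rw [h1, List.map_id]
  exact List.nodup_range'

theorem perm_operatorSlots :
    ((operatorSlots lam).map Slot.var).Perm
      ((positionSlots lam (lam.colLen 0 + lam.rowLen 0 - 1)).map Slot.var) := by
  rw [← map_var_staircase (operatorSlots lam), ← map_var_staircase (positionSlots _ _),
    staircase_operatorSlots]
  refine List.Perm.map _ ?_
  have h1 := List.filter_append_perm (fun y : Slot => y.mark)
    (staircase (positionSlots lam (lam.colLen 0 + lam.rowLen 0 - 1)))
  exact List.perm_append_comm.trans h1

/-- The marked exponents minus 1 sum to ∑ λ'_j + C(λ_1, 2) - λ_1, and the binomial coefficient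
cancels in `inversions_staircase`. -/
theorem inversions_staircase_positionSlots :
    inversions (staircase (positionSlots lam (lam.colLen 0 + lam.rowLen 0 - 1))) +
      lam.rowLen 0 = ((List.range (lam.rowLen 0)).map lam.colLen).sum := by
  have h1 := inversions_staircase (positionSlots lam (lam.colLen 0 + lam.rowLen 0 - 1)) (by
    intro y hy
    obtain ⟨k, -, rfl⟩ := List.mem_map.1 hy
    rfl)
  rw [filter_mark_staircase_positionSlots, List.length_map, List.length_range, List.map_map,
    ← sum_range_sub] at h1
  have h2 : ∀ (L : List ℕ) (f g : ℕ → ℤ),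
      (L.map fun j => f j + g j - 1).sum = (L.map f).sum + (L.map g).sum - L.length := by
    intro L f g
    induction L with
    | nil => rfl
    | cons j L ih =>
      simp only [List.map_cons, List.sum_cons, ih, List.length_cons]
      push_cast
      ring
  have h3 := h2 (List.range (lam.rowLen 0)) (fun j => (lam.colLen j : ℤ))
    fun j => ((lam.rowLen 0 - 1 - j : ℕ) : ℤ)
  have h4 : (((List.range (lam.rowLen 0)).map lam.colLen).sum : ℤ) =
      ((List.range (lam.rowLen 0)).map fun j => (lam.colLen j : ℤ)).sum := by
    rw [Nat.cast_list_sum, List.map_map]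
    rfl
  simp only [Function.comp_def] at h1
  rw [h3, List.length_range] at h1
  omega

end Slots

/-! ### The ribbon formula -/

section Main

variable {K : Type*} [Field K]

theorem map_neg_one_pow_mul (f : Lam K →+ Lam K) (n : ℕ) (Q : Lam K) :
    f ((-1) ^ n * Q) = (-1) ^ n * f Q := by
  rcases neg_one_pow_eq_or (Lam K) n with h1 | h1 <;> rw [h1] <;> simp

/-- `slotOp` as an additive map. -/
def slotOpHom (K : Type*) [Field K] (x : Slot) : Lam K →+ Lam K where
  toFun := slotOp x
  map_zero' := by simp [slotOp]
  map_add' Q Q' := by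
    have h1 : Function.Injective (AddMonoidAlgebra.single 0 : Lam K → LaurentLam K) :=
      AddMonoidAlgebra.single_right_injective
    apply h1
    rw [AddMonoidAlgebra.single_add, ← extract_shift_single_zero, ← extract_shift_single_zero,
      ← extract_shift_single_zero, AddMonoidAlgebra.single_add, map_add, map_add]

theorem allPairs_append_singleton (l : List Slot) (y : Slot) :
    allPairs K (l ++ [y]) =
      allPairs K l * (l.map fun x => 1 - z K y.var 1 * z K x.var (-1)).prod := by
  induction l with
  | nil => simp [allPairs]
  | cons x l ih =>
    rw [List.cons_append, allPairs, allPairs, ih]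
    simp only [List.map_append, List.map_cons, List.map_nil, List.prod_append, List.prod_cons,
      List.prod_nil]
    ring

theorem allPairs_positionSlots (lam : YoungDiagram) (m : ℕ) :
    allPairs K (positionSlots lam m) =
      ∏ j ∈ Finset.Icc 1 m, ∏ i ∈ Finset.Ico 1 j, (1 - z K j 1 * z K i (-1)) := by
  induction m with
  | zero => simp [positionSlots, allPairs]
  | succ m ih =>
    have h1 : positionSlots lam (m + 1) =
        positionSlots lam m ++ [⟨m + 1, decide (m ∉ descents lam), 1⟩] := by
      rw [positionSlots, List.range'_concat, List.map_append, positionSlots]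
      simp [add_comm]
    rw [h1, allPairs_append_singleton, ih, Finset.prod_Icc_succ_top (Nat.le_add_left 1 m)]
    congr 1
    rw [positionSlots, List.map_map, Finset.prod_eq_multiset_prod]
    have h2 : (Finset.Ico 1 (m + 1)).val = ((List.range' 1 m : List ℕ) : Multiset ℕ) := rfl
    rw [h2, Multiset.map_coe, Multiset.prod_coe]
    rfl

theorem sum_map_positionSlots {M : Type*} [AddCommMonoid M] (lam : YoungDiagram) (m : ℕ)
    (f : Slot → M) :
    ((positionSlots lam m).map f).sum =
      ∑ k ∈ Finset.Icc 1 m, f ⟨k, decide (k - 1 ∉ descents lam), 1⟩ := by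
  rw [positionSlots, List.map_map, Finset.sum_eq_multiset_sum]
  have h2 : (Finset.Icc 1 m).val = ((List.range' 1 m : List ℕ) : Multiset ℕ) := rfl
  rw [h2, Multiset.map_coe, Multiset.sum_coe]
  rfl

/-- Position 1 is always marked, which is why z_1 stands apart; position i + 1 is marked when i is
not a descent. -/
theorem markedSum_positionSlots (lam : YoungDiagram) (m : ℕ) (hm : 0 < m) :
    markedSum K (positionSlots lam m) =
      z K 1 1 + ∑ i ∈ Finset.Icc 1 (m - 1) \ descents lam, z K (i + 1) 1 := by
  obtain ⟨m, rfl⟩ := Nat.exists_eq_succ_of_ne_zero hm.ne'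
  have h0 : 0 ∉ descents lam := fun h0 => by
    have := (Finset.mem_Icc.1 (Finset.mem_filter.1 h0).1).1
    omega
  have h1 : Finset.Icc 1 (m + 1) = insert 1 ((Finset.Icc 1 m).image fun i => i + 1) := by
    ext k
    simp only [Finset.mem_insert, Finset.mem_image, Finset.mem_Icc]
    constructor
    · intro hk
      by_cases hk1 : k = 1
      · exact Or.inl hk1
      · exact Or.inr ⟨k - 1, by omega, by omega⟩
    · rintro (rfl | ⟨i, hi, rfl⟩) <;> omega
  rw [markedSum, sum_map_positionSlots, Nat.succ_eq_add_one, h1, Finset.sum_insert,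
    Finset.sum_image (fun i _ j _ hij => by simpa using hij), Finset.sdiff_eq_filter,
    Finset.sum_filter]
  · simp [h0]
  · simp

/-- Reversing rows and columns together keeps the determinant and lists the rows of λ^rc from the
top, as the slots do. -/
theorem schur_rc_eq_det (lam : YoungDiagram) :
    schur K (rc lam) = Matrix.det (Matrix.of fun i j : Fin (lam.colLen 0 - 1) =>
      hInt K (-(rowSlot lam i).exp + i - j)) := by
  rw [schur_eq_det _ _ (colLen_rc_le lam), ← Matrix.det_submatrix_equiv_self Fin.revPerm]
  congr 1
  ext1 i j
  simp only [Matrix.submatrix_apply, Matrix.of_apply, Fin.revPerm_apply, Fin.val_rev, rowSlot,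
    rowLen_rc, neg_neg]
  have hi := i.2
  have hj := j.2
  have h1 : lam.colLen 0 - 1 - (i + 1) + 1 = lam.colLen 0 - 1 - i := by omega
  rw [h1]
  congr 1
  omega

theorem alphabet_perm {l l' : List Slot} (hl : (l.map Slot.var).Perm (l'.map Slot.var)) :
    alphabet K l = alphabet K l' := by
  have h1 : ∀ l : List Slot, (l.map fun y => z K y.var (-1)) =
      (l.map Slot.var).map fun v => z K v (-1) := fun l => by rw [List.map_map]; rfl
  rw [alphabet, alphabet, h1, h1, (hl.map _).sum_eq]

theorem coeff_neg_one_pow_mul (n : ℕ) (F : LaurentLam K) (a : ℕ →₀ ℤ) :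
    ((-1) ^ n * F).coeff a = (-1) ^ n * F.coeff a := by
  induction n with
  | zero => simp
  | succ n ih =>
    have h1 : (-1 : LaurentLam K) ^ (n + 1) * F = -((-1) ^ n * F) := by ring
    rw [h1, AddMonoidAlgebra.coeff_neg, Finsupp.neg_apply, ih]
    ring

variable [CharZero K]

theorem foldr_Stilde (lam : YoungDiagram) (L : List ℕ) (P : Lam K) :
    L.foldr (fun j Q => Stilde (lam.colLen j : ℤ) Q) P = (-1) ^ (L.map lam.colLen).sum *
      (L.map fun j => (⟨lam.colLen 0 + j + 1 - lam.colLen j, true, lam.colLen j⟩ : Slot)).foldr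
        slotOp P := by
  induction L with
  | nil => simp
  | cons j L ih =>
    rw [List.foldr_cons, ih, Stilde_eq_slotOp (lam.colLen 0 + j + 1 - lam.colLen j)]
    have h1 := map_neg_one_pow_mul (slotOpHom K ⟨lam.colLen 0 + j + 1 - lam.colLen j, true,
      lam.colLen j⟩) (L.map lam.colLen).sum
    rw [show ∀ x Q, slotOp (K := K) x Q = slotOpHom K x Q from fun _ _ => rfl, h1,
      List.map_cons, List.map_cons, List.sum_cons, List.foldr_cons, pow_add, mul_assoc]
    rfl

theorem ribbonOp_eq_extractList (lam : YoungDiagram) (P : Lam K) :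
    ribbonOp lam P = (-1) ^ ((List.range (lam.rowLen 0)).map lam.colLen).sum *
      (extractList (operatorSlots lam) (allPairs K (operatorSlots lam) *
        pleth P (alphabet K (operatorSlots lam)))).coeff 0 := by
  have h1 : ∀ y ∈ columnSlots lam, y.mark = true := by
    intro y hy
    obtain ⟨j, -, rfl⟩ := List.mem_map.1 hy
    rfl
  have h2 := single_zero_perp_det (K := K) (lam.colLen 0 - 1) (fun i => rowSlot lam i)
    (fun _ => rfl) (columnSlots lam) h1
    ((perm_operatorSlots lam).nodup_iff.2 (nodup_positionSlots lam _)) P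
  rw [operatorSlots, ← h2, coeff_single_zero_zero, ribbonOp, foldr_Stilde, schur_rc_eq_det]
  exact map_neg_one_pow_mul (perpRight _).toAddMonoidHom _ _

end Main

end

end RibbonOp

open RibbonOp in
theorem mainTheorem7 {K : Type*} [Field K] [CharZero K]
    (lam : YoungDiagram) (hlam : lam ≠ ⊥) (m : ℕ) (hm : (ribbon lam).card = m) (P : Lam K) :
    ribbonOp lam P =
      (-1) ^ (m - (descents lam).card) *
        coeffOmega
          (pleth P (X K + ∑ i ∈ Finset.Icc 1 m, z K i (-1)) *
            ∏ j ∈ Finset.Icc 1 m, ∏ i ∈ Finset.Ico 1 j, (1 - z K j 1 * z K i (-1)))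
          (-(z K 1 1 + ∑ i ∈ Finset.Icc 1 (m - 1) \ descents lam, z K (i + 1) 1) * X K)
          (∑ i ∈ Finset.Icc 1 m, Finsupp.single i 1) := by
  have hl := colLen_zero_pos lam hlam
  have hr := rowLen_zero_pos lam hlam
  rw [card_ribbon] at hm
  subst hm
  have hsum : ((positionSlots lam (lam.colLen 0 + lam.rowLen 0 - 1)).map
      fun y => Finsupp.single y.var y.exp).sum =
      ∑ i ∈ Finset.Icc 1 (lam.colLen 0 + lam.rowLen 0 - 1), Finsupp.single i (1 : ℤ) :=
    sum_map_positionSlots lam _ _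
  have halpha : alphabet K (positionSlots lam (lam.colLen 0 + lam.rowLen 0 - 1)) =
      X K + ∑ i ∈ Finset.Icc 1 (lam.colLen 0 + lam.rowLen 0 - 1), z K i (-1) := by
    rw [alphabet, sum_map_positionSlots]
  have hnd := nodup_positionSlots lam (lam.colLen 0 + lam.rowLen 0 - 1)
  have hnd' := (perm_operatorSlots lam).nodup_iff.2 hnd
  -- Sorting the right-hand side yields the extraction of the operator side.
  have hpart := extractList_differences_partition (K := K) []
    (staircase (positionSlots lam (lam.colLen 0 + lam.rowLen 0 - 1)))
    (by rwa [map_var_staircase])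
    (pleth P (alphabet K (positionSlots lam (lam.colLen 0 + lam.rowLen 0 - 1))))
  rw [List.nil_append, List.nil_append, ← staircase_operatorSlots] at hpart
  rw [ribbonOp_eq_extractList, extractList_allPairs_mul _ hnd',
    alphabet_perm (perm_operatorSlots lam),
    ← markedSum_positionSlots lam _ (by omega), ← halpha, ← allPairs_positionSlots lam, ← hsum,
    coeffOmega_eq_extractList _ hnd, mul_comm (pleth P _), extractList_allPairs_mul _ hnd, hpart,
    coeff_neg_one_pow_mul, ← mul_assoc, ← pow_add, card_descents,
    ← inversions_staircase_positionSlots, add_comm (inversions _)]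
  -- Only the signs remain, that is, m - (ℓ - 1) = λ_1.
  congr 3
  omega
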